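/- A (generalised) triangulation $\mathcal T$ of dimension $d$ is a finite set of abstract $d$-simplices (facets) together with gluings of pairs of distinct $(d-1)$-faces (ridges), each gluing being the affine identification determined by a bijection of the vertices; each ridge is used in at most one gluing, and two ridges of the same simplex may be glued. $\mathcal T$ is closed if every ridge is used in a gluing. $|\mathcal T|$ denotes the quotient space, $f_d$ the number of facets and $f_0$ the number of vertices after identification. For $d,n\ge 1$ put $$B(d,n)=\begin{cases}\frac n2+d & \text{if } d \text{ is even, or if } d \text{ is odd, } n<d \text{ and } n \text{ is even},\\[2pt] n+\frac{d-1}{2} & \text{otherwise.}\end{cases}$$ Theorem. Let $\mathcal T$ be a closed triangulation of dimension $d$ such that $|\mathcal T|$ is a closed connected $d$-manifold. Then $f_0\le B(d,f_d)$ in each of the following cases: (i) $d=2$ (so that $f_0\le \frac{f_2}{2}+2$); (ii) $d$ is odd and $f_d\ge d$ (so that $f_0\le f_d+\frac{d-1}2$); (iii) $d$ is odd, and either $f_d<d$ with $f_d$ even (so that $f_0\le \frac{f_d}{2}+d$), or $f_d=1$ (so that $f_0\le 1+\frac{d-1}{2}$). Moreover, let $d\ge 1$ and call $n \ge 1$ feasible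 if some closed triangulation of dimension $d$ has exactly $n$ facets. The feasible $n$ are all positive integers if $d$ is odd, and all positive even integers if $d$ is even. For every $d \ge 1$ and every feasible $n$ there is a closed triangulation of the (standard PL) $d$-sphere with $f_d=n$ and $f_0=B(d,n)$. -/

import Mathlib

/-- A (finite) generalised triangulation of dimension `d`: a finite set of abstract `d`-simplices
(facets), each with vertices labelled by `Fin (d + 1)`, together with gluings of their
`(d - 1)`-faces (ridges). The ridge of a facet `σ` opposite to its vertex `i` is addressed as
`(σ, i)`. `glue σ i = none` means that this ridge is not glued, and `glue σ i = some (τ, π)` means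
that it is glued to the ridge `(τ, π i)`, where the vertex `j ≠ i` of `σ` is matched with the vertex
`π j` of `τ`; the value `π i` records the vertex opposite to the target ridge. -/
structure Triangulation (d : ℕ) where
  Facet : Type
  finite_facet : Finite Facet
  glue : Facet → Fin (d + 1) → Option (Facet × Equiv.Perm (Fin (d + 1)))
  /-- a gluing is an unordered pairing of two ridges -/
  glue_symm : ∀ σ i τ π, glue σ i = some (τ, π) → glue τ (π i) = some (σ, π.symm)
  /-- no ridge is glued to itself -/
  glue_ne_self : ∀ σ i τ π, glue σ i = some (τ, π) → (τ, π i) ≠ (σ, i)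

namespace Triangulation

variable {d : ℕ}

/-- The identifications of points made by the gluings: a point of the ridge `(σ, i)` is identified
with the point of the facet `τ` obtained by moving barycentric coordinates along the affine map
determined by the vertex pairing. -/
def PointRel (T : Triangulation d)
    (p q : Σ _ : T.Facet, stdSimplex ℝ (Fin (d + 1))) : Prop :=
  ∃ i π, T.glue p.1 i = some (q.1, π) ∧ p.2.1 i = 0 ∧ ∀ j, q.2.1 (π j) = p.2.1 j

/-- The underlying space `|T|`: the disjoint union of the facets modulo the equivalence relation
generated by the gluings, with the quotient topology. -/
def Realization (T : Triangulation d) : Type := Quot T.PointRel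

instance (T : Triangulation d) : TopologicalSpace T.Realization :=
  inferInstanceAs (TopologicalSpace (Quot T.PointRel))

/-- The characteristic map of a facet into the underlying space. -/
def facetMap (T : Triangulation d) (σ : T.Facet) (x : stdSimplex ℝ (Fin (d + 1))) :
    T.Realization :=
  Quot.mk T.PointRel ⟨σ, x⟩

/-- The identifications of vertices of facets made by the gluings. -/
def VertexRel (T : Triangulation d) (v w : T.Facet × Fin (d + 1)) : Prop :=
  ∃ i π, T.glue v.1 i = some (w.1, π) ∧ v.2 ≠ i ∧ w.2 = π v.2

/-- The number `f_0` of vertices (after the identifications). -/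
noncomputable def numVertices (T : Triangulation d) : ℕ := Nat.card (Quot T.VertexRel)

/-- The number `f_d` of facets. -/
noncomputable def numFacets (T : Triangulation d) : ℕ := Nat.card T.Facet

/-- A triangulation is closed if every ridge is used in a gluing. -/
def IsClosed (T : Triangulation d) : Prop := ∀ σ i, T.glue σ i ≠ none

end Triangulation

/-- A closed (that is, compact and without boundary) connected topological `d`-manifold. -/
structure IsClosedConnectedManifold (d : ℕ) (X : Type) [TopologicalSpace X] : Prop where
  compact : CompactSpace X
  hausdorff : T2Space X
  secondCountable : SecondCountableTopology X
  connected : ConnectedSpace X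
  locallyEuclidean : ∀ x : X, ∃ e : OpenPartialHomeomorph X (EuclideanSpace ℝ (Fin d)), x ∈ e.source

/-- `T` is a triangulation of a closed connected `d`-manifold. -/
def Triangulation.IsOfClosedConnectedManifold {d : ℕ} (T : Triangulation d) : Prop :=
  T.IsClosed ∧ IsClosedConnectedManifold d T.Realization

/-- A map from the standard simplex is piecewise affine: the simplex is a finite union of convex
polytopes on each of which the map is affine. (A continuous map with this property is a piecewise
linear map.) -/
def IsPiecewiseAffine {ι E : Type} [Fintype ι] [AddCommGroup E] [Module ℝ E]
    (f : stdSimplex ℝ ι → E) : Prop :=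
  ∃ (m : ℕ) (V : Fin m → Finset (ι → ℝ)),
    stdSimplex ℝ ι = ⋃ k, convexHull ℝ (V k : Set (ι → ℝ)) ∧
    ∀ k, ∃ A : (ι → ℝ) →ᵃ[ℝ] E,
      ∀ x : stdSimplex ℝ ι, x.1 ∈ convexHull ℝ (V k : Set (ι → ℝ)) → f x = A x.1

/-- `T` is a triangulation of the (standard piecewise linear) `d`-sphere: `T` is closed and `|T|` is
PL homeomorphic to the boundary of a `(d + 1)`-dimensional convex polytope in `ℝ^(d+1)`. (All such
boundaries are PL homeomorphic to each other, and homeomorphic to the round `d`-sphere.) -/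
def Triangulation.IsOfSphere {d : ℕ} (T : Triangulation d) : Prop :=
  T.IsClosed ∧
  ∃ V : Finset (EuclideanSpace ℝ (Fin (d + 1))),
    (interior (convexHull ℝ (V : Set (EuclideanSpace ℝ (Fin (d + 1)))))).Nonempty ∧
    ∃ h : T.Realization ≃ₜ frontier (convexHull ℝ (V : Set (EuclideanSpace ℝ (Fin (d + 1))))),
      ∀ σ : T.Facet, IsPiecewiseAffine
        (fun x => (h (T.facetMap σ x) : EuclideanSpace ℝ (Fin (d + 1))))

/-- The conjectured bound on the number of vertices in dimension `d` with `n` facets. -/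
def vertexBound (d n : ℕ) : ℚ :=
  if Even d ∨ (Odd d ∧ n < d ∧ Even n) then (n : ℚ) / 2 + d else n + ((d : ℚ) - 1) / 2

/-- `n` is a feasible number of facets in dimension `d`: some nonempty closed `d`-dimensional
triangulation has exactly `n` facets. -/
def IsFeasibleFacetNumber (d n : ℕ) : Prop :=
  0 < n ∧ ∃ T : Triangulation d, T.IsClosed ∧ T.numFacets = n

/-! ### Parity arguments over the two-element field: odd dimension. -/

open Module

/-! Upper bounds in odd dimension. Ridges are glued in pairs, so a function on ridges compatible
with the gluings has sum zero modulo 2 (`IsClosed.sum_ridges_eq_zero`). For a vertex `c` let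
`n_c(σ)` be the number of corners of `σ` at `c` modulo 2, and let `A`, which is `cornerSum`, be the
matrix with columns `n_c`. Applying the parity fact to the number of corners of a ridge at `c`, and
to products of three such numbers, gives `∑ n_c = 0` and `∑ n_a n_b n_c = 0` for distinct `a, b, c`.
The number of vertices is `rank A + dim ker A`, and both terms must be bounded.

A kernel weight is carried along gluings corner by corner, so it is determined by its values on one
facet `σ₀`. Group the corners of `σ₀` that no kernel weight distinguishes. If all classes have even
size, there are at most `(d + 1) / 2` of them, which bounds `dim ker A`, while `∑ n_c = 0` gives
`rank A ≤ f_d - 1`. If some class is odd, the indicator of its transport is a weight with corner sum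
1 on every facet. Inserting it, or a kernel weight, into the triple products gives `∑ n_a n_b = 0`
for all `a, b` (`gram_eq_zero_of_weight`), so the column space is isotropic and has rank at most
`f_d / 2`, while `dim ker A ≤ d`. For `f_d ≥ d` the first bound is the weaker one, for `f_d < d` the
second. For one facet it is enough that every vertex has an even number of corners.

In dimension 2 the bound is the inequality `f_0 - f_1 + f_2 ≤ 2`, obtained from cochains modulo 2.

Sharpness comes from two families: the double of a simplex with one edge subdivided, and the join of
a cycle with circles made of one edge each. They are parametrized onto the boundary of a simplex and
of a cross-polytope by explicit piecewise affine maps whose only identifications are the gluings;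
`IsClosed.isOfSphere` turns this into a PL homeomorphism. -/

/-- The dot product embeds `W` into its own annihilator, whose dimension is complementary. -/
theorem two_mul_finrank_le_of_isotropic {ι : Type*} [Fintype ι] {K : Type*} [Field K]
    (W : Submodule K (ι → K)) (h : ∀ u ∈ W, ∀ v ∈ W, ∑ i, u i * v i = 0) :
    2 * finrank K W ≤ Fintype.card ι := by
  classical
  have h1 : W.map (dotProductEquiv K ι : (ι → K) →ₗ[K] Dual K (ι → K)) ≤ W.dualAnnihilator := by
    rintro _ ⟨u, hu, rfl⟩
    rw [Submodule.mem_dualAnnihilator]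
    intro v hv
    simpa [dotProductEquiv, dotProduct] using h u hu v hv
  have h2 := Submodule.finrank_mono h1
  have h3 := Subspace.finrank_add_finrank_dualAnnihilator_eq W
  have h4 : finrank K (W.map (dotProductEquiv K ι : (ι → K) →ₗ[K] Dual K (ι → K))) = finrank K W :=
    LinearEquiv.finrank_map_eq (dotProductEquiv K ι) W
  rw [finrank_fintype_fun_eq_card] at h3
  omega

theorem two_mul_card_le_of_forall_even_fiber {α β : Type*} [Fintype α] [Fintype β] [DecidableEq β]
    (g : α → β) (hg : Function.Surjective g)
    (h : ∀ a, Even (Finset.univ.filter fun x => g x = g a).card) :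
    2 * Fintype.card β ≤ Fintype.card α := by
  have h1 : Fintype.card α = ∑ b : β, (Finset.univ.filter fun x => g x = b).card :=
    Finset.card_eq_sum_card_fiberwise (fun _ _ => Finset.mem_coe.2 (Finset.mem_univ _))
  have h2 : ∀ b ∈ (Finset.univ : Finset β), 2 ≤ (Finset.univ.filter fun x => g x = b).card := by
    intro b _
    obtain ⟨a, rfl⟩ := hg b
    have h3 : 0 < (Finset.univ.filter fun x => g x = g a).card :=
      Finset.card_pos.2 ⟨a, by simp⟩
    obtain ⟨m, hm⟩ := h a
    omega
  have h4 := Finset.card_nsmul_le_sum _ _ _ h2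
  rw [h1]
  simpa [mul_comm] using h4

namespace Triangulation

variable {d : ℕ} (T : Triangulation d)

/-- The vertex of the triangulation at the corner `i` of the facet `σ`. -/
def vtx (σ : T.Facet) (i : Fin (d + 1)) : Quot T.VertexRel := Quot.mk _ (σ, i)

variable {T}

theorem vtx_surjective (c : Quot T.VertexRel) : ∃ σ i, T.vtx σ i = c := by
  induction c using Quot.ind with
  | mk p => exact ⟨p.1, p.2, rfl⟩

theorem vtx_eq_of_glue {σ τ : T.Facet} {i : Fin (d + 1)} {π : Equiv.Perm (Fin (d + 1))}
    (h : T.glue σ i = some (τ, π)) {j : Fin (d + 1)} (hj : j ≠ i) :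
    T.vtx σ j = T.vtx τ (π j) :=
  Quot.sound ⟨i, π, h, hj, rfl⟩

theorem IsClosed.exists_glue (hT : T.IsClosed) (σ : T.Facet) (i : Fin (d + 1)) :
    ∃ τ π, T.glue σ i = some (τ, π) := by
  obtain ⟨⟨τ, π⟩, h⟩ := Option.ne_none_iff_exists'.1 (hT σ i)
  exact ⟨τ, π, h⟩

variable (T) in
/-- Any two facets are joined by a chain of glued ridges. -/
def IsStronglyConnected : Prop :=
  ∀ P : T.Facet → Prop, (∀ σ i τ π, T.glue σ i = some (τ, π) → P σ → P τ) → ∀ σ τ, P σ → P τ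

/-- A property of facets invariant under gluing cuts out a clopen subset of the realization. -/
theorem isStronglyConnected_of_connectedSpace (h : ConnectedSpace T.Realization) :
    T.IsStronglyConnected := by
  intro P hP σ τ hσ
  have key : ∀ p q, T.PointRel p q → (P p.1 = P q.1) := by
    rintro p q ⟨i, π, hg, -, -⟩
    exact propext ⟨hP _ _ _ _ hg, hP _ _ _ _ (T.glue_symm _ _ _ _ hg)⟩
  let A : Set T.Realization := {q | Quot.lift (fun p => P p.1) key q}
  have hq : Topology.IsQuotientMap (Quot.mk T.PointRel : _ → T.Realization) :=
    isQuotientMap_quot_mk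
  have hop : ∀ R : T.Facet → Prop,
      IsOpen {p : Σ _ : T.Facet, stdSimplex ℝ (Fin (d + 1)) | R p.1} := by
    intro R
    rw [isOpen_sigma_iff]
    intro σ
    by_cases hR : R σ <;> simp [hR]
  have hA : IsClopen A := by
    constructor
    · exact ⟨hq.isOpen_preimage.1 (hop fun σ => ¬ P σ)⟩
    · exact hq.isOpen_preimage.1 (hop P)
  obtain ⟨x⟩ : Nonempty (stdSimplex ℝ (Fin (d + 1))) := inferInstance
  rcases isClopen_iff.1 hA with h0 | h0
  · have : Quot.mk T.PointRel ⟨σ, x⟩ ∈ A := hσ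
    rw [h0] at this
    exact this.elim
  · have : Quot.mk T.PointRel ⟨τ, x⟩ ∈ A := h0 ▸ Set.mem_univ _
    exact this

theorem nonempty_facet_of_connectedSpace (h : ConnectedSpace T.Realization) :
    Nonempty T.Facet := by
  obtain ⟨q⟩ := h.toNonempty
  induction q using Quot.ind with
  | mk p => exact ⟨p.1⟩

section Parity

variable [Fintype T.Facet] (hT : T.IsClosed)
include hT

/-- A function on ridges which is compatible with the gluings has an even sum. -/
theorem IsClosed.sum_ridges_eq_zero (φ : T.Facet → Fin (d + 1) → ZMod 2)
    (hφ : ∀ σ i τ π, T.glue σ i = some (τ, π) → φ τ (π i) = φ σ i) :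
    ∑ σ, ∑ i, φ σ i = 0 := by
  classical
  choose τ π hg using hT.exists_glue
  rw [← Fintype.sum_prod_type' (f := φ)]
  -- Passing to the other side of a gluing is an involution on ridges without fixed points, and the
  -- two equal values cancel in characteristic two.
  refine Finset.sum_involution (fun p _ => (τ p.1 p.2, π p.1 p.2 p.2)) ?_ ?_ ?_ ?_
  · rintro ⟨σ, i⟩ -
    rw [hφ _ _ _ _ (hg σ i)]
    exact CharTwo.add_self_eq_zero _
  · rintro ⟨σ, i⟩ - -
    exact T.glue_ne_self _ _ _ _ (hg σ i)
  · simp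
  · rintro ⟨σ, i⟩ -
    have h1 := T.glue_symm _ _ _ _ (hg σ i)
    rw [hg] at h1
    obtain ⟨h2, h3⟩ := Prod.ext_iff.1 (Option.some.inj h1)
    simp only at h2 h3
    simp [h2, h3]

end Parity

variable (T) in
/-- The number, modulo two, of corners of a facet at a weighted set of vertices. -/
def cornerSum : (Quot T.VertexRel → ZMod 2) →ₗ[ZMod 2] (T.Facet → ZMod 2) where
  toFun s σ := ∑ j, s (T.vtx σ j)
  map_add' s t := by ext σ; simp [Finset.sum_add_distrib]
  map_smul' a s := by ext σ; simp [Finset.mul_sum]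

theorem cornerSum_apply (s : Quot T.VertexRel → ZMod 2) (σ : T.Facet) :
    T.cornerSum s σ = ∑ j, s (T.vtx σ j) := rfl

/-- The sum over a ridge is the same on both sides of a gluing. -/
theorem cornerSum_sub_glue (s : Quot T.VertexRel → ZMod 2) {σ τ : T.Facet} {i : Fin (d + 1)}
    {π : Equiv.Perm (Fin (d + 1))} (h : T.glue σ i = some (τ, π)) :
    T.cornerSum s τ - s (T.vtx τ (π i)) = T.cornerSum s σ - s (T.vtx σ i) := by
  simp only [cornerSum_apply]
  rw [← Equiv.sum_comp π (fun j => s (T.vtx τ j)),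
    ← Finset.add_sum_erase _ _ (Finset.mem_univ i),
    ← Finset.add_sum_erase _ (fun j => s (T.vtx σ j)) (Finset.mem_univ i),
    add_sub_cancel_left, add_sub_cancel_left]
  refine Finset.sum_congr rfl fun j hj => ?_
  rw [vtx_eq_of_glue h (by simpa using hj)]

/-- The corners on the ridge are identified anyway. For the two opposite corners, both facet sums
vanish and the ridge sums agree, so the remaining terms agree as well. -/
theorem vtx_glue_of_cornerSum_eq_zero {s : Quot T.VertexRel → ZMod 2} (hs : T.cornerSum s = 0)
    {σ τ : T.Facet} {i : Fin (d + 1)} {π : Equiv.Perm (Fin (d + 1))}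
    (h : T.glue σ i = some (τ, π)) (j : Fin (d + 1)) :
    s (T.vtx τ (π j)) = s (T.vtx σ j) := by
  by_cases hj : j = i
  · subst hj
    simpa [hs] using cornerSum_sub_glue s h
  · rw [vtx_eq_of_glue h hj]

section Gram

open scoped Classical in
variable (T) in
/-- The number, modulo two, of corners of a facet at a given vertex. -/
noncomputable def corners (c : Quot T.VertexRel) : T.Facet → ZMod 2 :=
  T.cornerSum (Pi.single c 1)

open scoped Classical in
theorem corners_apply (c : Quot T.VertexRel) (σ : T.Facet) :
    T.corners c σ = ∑ j, if T.vtx σ j = c then 1 else 0 := by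
  simp [corners, cornerSum_apply, Pi.single_apply]

theorem cornerSum_eq_sum_corners [Fintype (Quot T.VertexRel)] (s : Quot T.VertexRel → ZMod 2)
    (σ : T.Facet) : T.cornerSum s σ = ∑ c, s c * T.corners c σ := by
  classical
  have : s = ∑ c, s c • Pi.single c (1 : ZMod 2) := by
    ext a
    simp [Finset.sum_apply, Pi.single_apply]
  conv_lhs => rw [this]
  simp [corners, map_sum]

variable [Fintype T.Facet] (hT : T.IsClosed)
include hT

/-- Count the corners at `c` on each ridge: every corner of a facet lies on `d` of its ridges, and
`d` is odd. -/
theorem IsClosed.sum_corners_eq_zero (hd : Odd d) (c : Quot T.VertexRel) :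
    ∑ σ, T.corners c σ = 0 := by
  classical
  have h := hT.sum_ridges_eq_zero
    (fun σ i => T.corners c σ - if T.vtx σ i = c then 1 else 0) (by
      intro σ i τ π hg
      simpa [corners, Pi.single_apply] using cornerSum_sub_glue (Pi.single c 1) hg)
  rw [← h]
  refine Finset.sum_congr rfl fun σ _ => ?_
  rw [Finset.sum_sub_distrib, ← corners_apply]
  obtain ⟨m, rfl⟩ := hd
  have h2 : (2 : ZMod 2) = 0 := rfl
  simp only [Finset.sum_const, Finset.card_univ, Fintype.card_fin, nsmul_eq_mul]
  push_cast
  linear_combination (-(m : ZMod 2)) * T.corners c σ * h2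

/-- Multiply the counts of the three vertices on a ridge. Omitting one corner changes at most one
factor, so over the `d + 1` ridges of a facet the products add up to `(d + 1) - 3` times the facet
product, an odd multiple. With two factors the multiple would be even and nothing would follow. -/
theorem IsClosed.sum_corners_mul_mul_eq_zero (hd : Odd d) {a b c : Quot T.VertexRel}
    (hab : a ≠ b) (hac : a ≠ c) (hbc : b ≠ c) :
    ∑ σ, T.corners a σ * T.corners b σ * T.corners c σ = 0 := by
  classical
  let e : Quot T.VertexRel → T.Facet → Fin (d + 1) → ZMod 2 :=
    fun v σ i => if T.vtx σ i = v then 1 else 0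
  have hinv : ∀ v, ∀ σ i τ π, T.glue σ i = some (τ, π) →
      T.corners v τ - e v τ (π i) = T.corners v σ - e v σ i := by
    intro v σ i τ π hg
    simpa [corners, Pi.single_apply, e] using cornerSum_sub_glue (Pi.single v 1) hg
  have he : ∀ u v, u ≠ v → ∀ σ i, e u σ i * e v σ i = 0 := by
    intro u v huv σ i
    by_cases h : T.vtx σ i = u
    · simp [e, h, huv]
    · simp [e, h]
  have hsum : ∀ v σ, ∑ i, e v σ i = T.corners v σ := fun v σ => (corners_apply v σ).symm
  have h := hT.sum_ridges_eq_zero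
    (fun σ i => (T.corners a σ - e a σ i) * (T.corners b σ - e b σ i) *
      (T.corners c σ - e c σ i)) (by
      intro σ i τ π hg
      simp only [hinv _ σ i τ π hg])
  rw [← h]
  refine Finset.sum_congr rfl fun σ _ => ?_
  have hexp : ∀ i, (T.corners a σ - e a σ i) * (T.corners b σ - e b σ i) *
      (T.corners c σ - e c σ i) = T.corners a σ * T.corners b σ * T.corners c σ
      - T.corners b σ * T.corners c σ * e a σ i - T.corners a σ * T.corners c σ * e b σ i
      - T.corners a σ * T.corners b σ * e c σ i := by
    intro i
    linear_combination (T.corners c σ - e c σ i) * he a b hab σ i +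
      T.corners b σ * he a c hac σ i + T.corners a σ * he b c hbc σ i
  simp only [hexp, Finset.sum_sub_distrib, ← Finset.mul_sum, hsum]
  obtain ⟨m, rfl⟩ := hd
  have h2 : (2 : ZMod 2) = 0 := rfl
  simp only [Finset.sum_const, Finset.card_univ, Fintype.card_fin, nsmul_eq_mul]
  push_cast
  linear_combination (1 - (m : ZMod 2)) * T.corners a σ * T.corners b σ * T.corners c σ * h2

/-- A weight with constant corner sum forces orthogonality. -/
theorem IsClosed.gram_eq_zero_of_weight (hd : Odd d) {s : Quot T.VertexRel → ZMod 2} {κ : ZMod 2}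
    (hs : ∀ σ, T.cornerSum s σ = κ) {a b : Quot T.VertexRel} (hab : a ≠ b)
    (hκ : κ + s a + s b ≠ 0) : ∑ σ, T.corners a σ * T.corners b σ = 0 := by
  classical
  have := T.finite_facet
  have : Fintype (Quot T.VertexRel) := Fintype.ofFinite _
  have hsq : ∀ x : ZMod 2, x * x = x := by decide
  -- Replace the constant `κ` by the corner sum of `s` inside the sum over facets.
  have h1 : κ * ∑ σ, T.corners a σ * T.corners b σ =
      ∑ c, s c * ∑ σ, T.corners a σ * T.corners b σ * T.corners c σ := by
    simp only [Finset.mul_sum]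
    rw [Finset.sum_comm]
    refine Finset.sum_congr rfl fun σ _ => ?_
    rw [← hs σ, cornerSum_eq_sum_corners, Finset.sum_mul]
    exact Finset.sum_congr rfl fun c _ => by ring
  -- Only `c = a` and `c = b` survive the triple product relation, and there `x * x = x` reduces the
  -- triple product to the double one.
  have h2 : ∑ c, s c * ∑ σ, T.corners a σ * T.corners b σ * T.corners c σ =
      (s a + s b) * ∑ σ, T.corners a σ * T.corners b σ := by
    rw [← Finset.sum_subset (Finset.subset_univ {a, b}), Finset.sum_pair hab, add_mul]
    · congr 2
      · exact Finset.sum_congr rfl fun σ _ => by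
          linear_combination T.corners b σ * hsq (T.corners a σ)
      · exact Finset.sum_congr rfl fun σ _ => by
          linear_combination T.corners a σ * hsq (T.corners b σ)
    · intro c _ hc
      simp only [Finset.mem_insert, Finset.mem_singleton, not_or] at hc
      rw [hT.sum_corners_mul_mul_eq_zero hd hab (Ne.symm hc.1) (Ne.symm hc.2), mul_zero]
  have h3 : (κ + s a + s b) * ∑ σ, T.corners a σ * T.corners b σ = 0 := by
    rw [add_assoc, add_mul, h1, h2]
    exact CharTwo.add_self_eq_zero _
  exact (mul_eq_zero.1 h3).resolve_left hκ

end Gram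

theorem exists_weight_ne {K : Submodule (ZMod 2) (Quot T.VertexRel → ZMod 2)}
    {a b : Quot T.VertexRel} (h : ¬ ∀ s ∈ K, s a = s b) : ∃ s ∈ K, s a + s b ≠ 0 := by
  push Not at h
  obtain ⟨s, hs, hne⟩ := h
  exact ⟨s, hs, fun h0 => hne (CharTwo.add_eq_zero.1 h0)⟩

theorem IsStronglyConnected.eq_zero_of_cornerSum (hc : T.IsStronglyConnected) (σ : T.Facet)
    {s : Quot T.VertexRel → ZMod 2} (hs : T.cornerSum s = 0) (h : ∀ j, s (T.vtx σ j) = 0) :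
    s = 0 := by
  have key : ∀ τ, ∀ j, s (T.vtx τ j) = 0 := by
    intro τ
    refine hc (fun τ => ∀ j, s (T.vtx τ j) = 0) ?_ σ τ h
    intro σ i τ π hg h j
    rw [← π.apply_symm_apply j, vtx_glue_of_cornerSum_eq_zero hs hg]
    exact h _
  ext c
  obtain ⟨τ, j, rfl⟩ := vtx_surjective c
  exact key τ j

/-- In odd dimension, the vertices are few in one of two ways. -/
theorem IsClosed.numVertices_le_or (hT : T.IsClosed) (hc : T.IsStronglyConnected)
    (hne : Nonempty T.Facet) (hd : Odd d) :
    2 * T.numVertices ≤ T.numFacets + 2 * d ∨ 2 * T.numVertices + 1 ≤ 2 * T.numFacets + d := by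
  classical
  have := T.finite_facet
  have : Fintype T.Facet := Fintype.ofFinite _
  have : Fintype (Quot T.VertexRel) := Fintype.ofFinite _
  obtain ⟨σ₀⟩ := hne
  have hsq : ∀ x : ZMod 2, x * x = x := by decide
  have hrn := T.cornerSum.finrank_range_add_finrank_ker
  rw [finrank_fintype_fun_eq_card] at hrn
  simp only [numVertices, numFacets, Nat.card_eq_fintype_card]
  set K := LinearMap.ker T.cornerSum with hK
  -- Corners of `σ₀` are equivalent when no kernel weight tells them apart; the parity of the class
  -- sizes decides which bound holds.
  let r : Setoid (Fin (d + 1)) :=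
    { r := fun j k => ∀ s ∈ K, s (T.vtx σ₀ j) = s (T.vtx σ₀ k)
      iseqv := ⟨fun _ _ _ => rfl, fun h s hs => (h s hs).symm,
        fun h h' s hs => (h s hs).trans (h' s hs)⟩ }
  by_cases heven : ∀ j, Even (Finset.univ.filter
    fun k => (Quotient.mk r k) = Quotient.mk r j).card
  · right
    have h1 : finrank (ZMod 2) K ≤ Fintype.card (Quotient r) := by
      let f : K →ₗ[ZMod 2] (Quotient r → ZMod 2) :=
        { toFun := fun s q => s.1 (T.vtx σ₀ q.out)
          map_add' := fun s t => by ext; simp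
          map_smul' := fun a s => by ext; simp }
      have hf : Function.Injective f := by
        rw [← LinearMap.ker_eq_bot, LinearMap.ker_eq_bot']
        intro s hs
        refine Subtype.ext (hc.eq_zero_of_cornerSum σ₀ s.2 fun j => ?_)
        have h3 : r (Quotient.mk r j).out j := Quotient.mk_out j
        rw [← h3 s.1 s.2]
        exact congrFun hs (Quotient.mk r j)
      simpa using LinearMap.finrank_le_finrank_of_injective hf
    have h2 := two_mul_card_le_of_forall_even_fiber (Quotient.mk r) Quotient.mk_surjective heven
    rw [Fintype.card_fin] at h2
    -- Every column has sum zero over the facets, so the range misses the basis vector of `σ₀`.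
    have h3 : finrank (ZMod 2) (LinearMap.range T.cornerSum) < Fintype.card T.Facet := by
      rw [← finrank_fintype_fun_eq_card (ZMod 2)]
      apply Submodule.finrank_lt
      intro htop
      have h4 : ∀ u ∈ LinearMap.range T.cornerSum, ∑ σ, u σ = 0 := by
        rintro _ ⟨s, rfl⟩
        simp only [cornerSum_eq_sum_corners]
        rw [Finset.sum_comm]
        simp [← Finset.mul_sum, hT.sum_corners_eq_zero hd]
      have h5 := h4 (Pi.single σ₀ 1) (htop ▸ Submodule.mem_top)
      simp at h5
    omega
  · left
    push Not at heven
    obtain ⟨j₀, hj₀⟩ := heven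
    -- A kernel weight sums to zero over the `d + 1` corners of `σ₀`, so `d` of its values there
    -- determine it.
    have h1 : finrank (ZMod 2) K ≤ d := by
      let f : K →ₗ[ZMod 2] (Fin d → ZMod 2) :=
        { toFun := fun s j => s.1 (T.vtx σ₀ j.succ)
          map_add' := fun s t => by ext; simp
          map_smul' := fun a s => by ext; simp }
      have hf : Function.Injective f := by
        rw [← LinearMap.ker_eq_bot, LinearMap.ker_eq_bot']
        intro s hs
        have h3 : ∀ j : Fin d, s.1 (T.vtx σ₀ j.succ) = 0 := fun j => congrFun hs j
        have h4 : T.cornerSum s.1 σ₀ = 0 := congrFun s.2 σ₀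
        rw [cornerSum_apply, Fin.sum_univ_succ] at h4
        simp only [h3, Finset.sum_const_zero, add_zero] at h4
        exact Subtype.ext (hc.eq_zero_of_cornerSum σ₀ s.2 fun j => Fin.cases h4 h3 j)
      simpa using LinearMap.finrank_le_finrank_of_injective hf
    -- The indicator of all vertices that kernel weights do not distinguish from the odd class.
    -- Transport along gluings preserves this set, so the corner sum of `S` is the same on all
    -- facets; on `σ₀` it is the odd class size.
    let S : Quot T.VertexRel → ZMod 2 :=
      fun c => if ∀ s ∈ K, s c = s (T.vtx σ₀ j₀) then 1 else 0
    have hS : ∀ σ, T.cornerSum S σ = 1 := by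
      intro σ
      refine hc (fun σ => T.cornerSum S σ = 1) ?_ σ₀ σ ?_
      · intro σ i τ π hg h
        rw [← h, cornerSum_apply, cornerSum_apply, ← Equiv.sum_comp π]
        refine Finset.sum_congr rfl fun j _ => ?_
        have h5 : ∀ s ∈ K, s (T.vtx τ (π j)) = s (T.vtx σ j) :=
          fun s hs => vtx_glue_of_cornerSum_eq_zero hs hg j
        have : (∀ s ∈ K, s (T.vtx τ (π j)) = s (T.vtx σ₀ j₀)) ↔
            ∀ s ∈ K, s (T.vtx σ j) = s (T.vtx σ₀ j₀) :=
          forall₂_congr fun s hs => by rw [h5 s hs]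
        simp only [S, this]
      · rw [cornerSum_apply, Finset.sum_boole]
        have h6 : (Finset.univ.filter fun k => ∀ s ∈ K, s (T.vtx σ₀ k) = s (T.vtx σ₀ j₀)) =
            Finset.univ.filter fun k => (Quotient.mk r k) = Quotient.mk r j₀ := by
          ext k
          simp only [Finset.mem_filter, Finset.mem_univ, true_and]
          exact (Quotient.eq (r := r)).symm
        rw [h6]
        exact ZMod.natCast_eq_one_iff_odd.2 (Nat.not_even_iff_odd.1 hj₀)
    -- If kernel weights do not separate `a` from `b`, then `S a = S b` and the weight `S` with `κ =
    -- 1` applies; otherwise a separating kernel weight with `κ = 0` does.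
    have hG : ∀ a b, ∑ σ, T.corners a σ * T.corners b σ = 0 := by
      intro a b
      by_cases hab : a = b
      · subst hab
        simpa only [hsq] using hT.sum_corners_eq_zero hd a
      · by_cases h : ∀ s ∈ K, s a = s b
        · refine hT.gram_eq_zero_of_weight hd hS hab ?_
          have : S a = S b := by
            have : (∀ s ∈ K, s a = s (T.vtx σ₀ j₀)) ↔ ∀ s ∈ K, s b = s (T.vtx σ₀ j₀) :=
              forall₂_congr fun s hs => by rw [h s hs]
            simp only [S, this]
          rw [this, add_assoc, CharTwo.add_self_eq_zero]
          decide
        · obtain ⟨s, hs, hne⟩ := exists_weight_ne h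
          exact hT.gram_eq_zero_of_weight hd (κ := 0) (fun σ => congrFun hs σ) hab
            (by rwa [zero_add])
    have h2 := two_mul_finrank_le_of_isotropic (LinearMap.range T.cornerSum) (by
      rintro _ ⟨s, rfl⟩ _ ⟨t, rfl⟩
      simp only [cornerSum_eq_sum_corners, Finset.sum_mul_sum]
      rw [Finset.sum_comm]
      refine Finset.sum_eq_zero fun a _ => ?_
      rw [Finset.sum_comm]
      refine Finset.sum_eq_zero fun b _ => ?_
      have : ∑ σ, s a * T.corners a σ * (t b * T.corners b σ) =
          s a * t b * ∑ σ, T.corners a σ * T.corners b σ := by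
        rw [Finset.mul_sum]
        exact Finset.sum_congr rfl fun σ _ => by ring
      rw [this, hG, mul_zero])
    omega

/-- In odd dimension every vertex has an even number of corners. -/
theorem IsClosed.two_mul_numVertices_le (hT : T.IsClosed) (hd : Odd d) :
    2 * T.numVertices ≤ T.numFacets * (d + 1) := by
  classical
  have := T.finite_facet
  have : Fintype T.Facet := Fintype.ofFinite _
  have : Fintype (Quot T.VertexRel) := Fintype.ofFinite _
  have h := two_mul_card_le_of_forall_even_fiber
    (fun p : T.Facet × Fin (d + 1) => T.vtx p.1 p.2)
    (fun c => by obtain ⟨σ, j, h⟩ := vtx_surjective c; exact ⟨(σ, j), h⟩) (fun p => by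
      have h1 := hT.sum_corners_eq_zero hd (T.vtx p.1 p.2)
      simp only [corners_apply] at h1
      rw [← Fintype.sum_prod_type'
        (f := fun σ j => if T.vtx σ j = T.vtx p.1 p.2 then (1 : ZMod 2) else 0),
        Finset.sum_boole] at h1
      exact (ZMod.natCast_eq_zero_iff_even).1 h1)
  simpa [numVertices, numFacets, Nat.card_eq_fintype_card] using h

/-- The `f_d (d + 1)` ridges are paired up, and `d + 1` is odd. -/
theorem IsClosed.even_numFacets (hT : T.IsClosed) (hd : Even d) : Even T.numFacets := by
  classical
  have := T.finite_facet
  have : Fintype T.Facet := Fintype.ofFinite _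
  have h := hT.sum_ridges_eq_zero (fun _ _ => 1) (fun _ _ _ _ _ => rfl)
  simp only [Finset.sum_const, Finset.card_univ, Fintype.card_fin, nsmul_eq_mul,
    mul_one] at h
  rw [numFacets, Nat.card_eq_fintype_card]
  have h1 : ((Fintype.card T.Facet * (d + 1) : ℕ) : ZMod 2) = 0 := by exact_mod_cast h
  rw [ZMod.natCast_eq_zero_iff_even, Nat.even_mul] at h1
  exact h1.resolve_right (by simpa [Nat.even_add_one] using hd)

end Triangulation

/-! ### The bound for surfaces. -/

namespace Triangulation

theorem glue_target_eq_iff {d : ℕ} {T : Triangulation d} {σ τ σ' τ' : T.Facet} {i i' : Fin (d + 1)}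
    {π π' : Equiv.Perm (Fin (d + 1))} (hg : T.glue σ i = some (τ, π))
    (hg' : T.glue σ' i' = some (τ', π')) : (τ', π' i') = (σ, i) ↔ (σ', i') = (τ, π i) := by
  simp only [Prod.mk.injEq]
  constructor
  · rintro ⟨rfl, rfl⟩
    have h2 := T.glue_symm _ _ _ _ hg'
    rw [hg] at h2
    simp only [Option.some.injEq, Prod.mk.injEq] at h2
    simp [h2.1, h2.2]
  · rintro ⟨rfl, rfl⟩
    have h2 := T.glue_symm _ _ _ _ hg
    rw [hg'] at h2
    simp only [Option.some.injEq, Prod.mk.injEq] at h2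
    simp [h2.1, h2.2]

/-- In the cochain complex from vertices through edges to triangles modulo 2, connectedness gives
the first map a kernel of dimension at most 1 and the last map corank at most 1. Since the composite
vanishes, `f_0 - 1 ≤ dim C - (f_2 - 1)`, and `dim C ≤ 3 f_2 / 2`. -/
theorem two_mul_numVertices_le_of_two {T : Triangulation 2} (hT : T.IsClosed)
    (hc : T.IsStronglyConnected) (hne : Nonempty T.Facet) :
    2 * T.numVertices ≤ T.numFacets + 4 := by
  classical
  have := T.finite_facet
  have : Fintype T.Facet := Fintype.ofFinite _
  have : Fintype (Quot T.VertexRel) := Fintype.ofFinite _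
  obtain ⟨σ₀⟩ := hne
  -- The 1-cochains: functions on ridges that agree across gluings. Products of two of them have
  -- even sum, so `C` is isotropic.
  let C : Submodule (ZMod 2) (T.Facet × Fin 3 → ZMod 2) :=
    { carrier := {e | ∀ σ i τ π, T.glue σ i = some (τ, π) → e (τ, π i) = e (σ, i)}
      add_mem' := by
        intro e f he hf σ i τ π h
        simp [he σ i τ π h, hf σ i τ π h]
      zero_mem' := by simp
      smul_mem' := by
        intro a e he σ i τ π h
        simp [he σ i τ π h] }
  have hC : 2 * finrank (ZMod 2) C ≤ Fintype.card T.Facet * 3 := by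
    have h := two_mul_finrank_le_of_isotropic C (by
      intro u hu v hv
      rw [Fintype.sum_prod_type]
      refine hT.sum_ridges_eq_zero (fun σ i => u (σ, i) * v (σ, i)) ?_
      intro σ i τ π h
      rw [hu σ i τ π h, hv σ i τ π h])
    simpa using h
  let bd : (T.Facet × Fin 3 → ZMod 2) →ₗ[ZMod 2] (T.Facet → ZMod 2) :=
    { toFun := fun e σ => ∑ i, e (σ, i)
      map_add' := fun e f => by ext σ; simp [Finset.sum_add_distrib]
      map_smul' := fun a e => by ext σ; simp [Finset.mul_sum] }
  let cb : (Quot T.VertexRel → ZMod 2) →ₗ[ZMod 2] (T.Facet × Fin 3 → ZMod 2) :=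
    { toFun := fun s p => T.cornerSum s p.1 - s (T.vtx p.1 p.2)
      map_add' := fun s t => by ext σ; simp; ring
      map_smul' := fun a s => by ext σ; simp; ring }
  have hrn := cb.finrank_range_add_finrank_ker
  rw [finrank_fintype_fun_eq_card] at hrn
  have hker : finrank (ZMod 2) (LinearMap.ker cb) ≤ 1 := by
    let f : LinearMap.ker cb →ₗ[ZMod 2] ZMod 2 :=
      { toFun := fun s => s.1 (T.vtx σ₀ 0)
        map_add' := fun s t => by simp
        map_smul' := fun a s => by simp }
    have hf : Function.Injective f := by
      rw [← LinearMap.ker_eq_bot, LinearMap.ker_eq_bot']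
      intro s hs
      have h0 : ∀ σ j, s.1 (T.vtx σ j) = T.cornerSum s.1 σ :=
        fun σ j => (sub_eq_zero.1 (congrFun s.2 (σ, j))).symm
      have h1 : ∀ σ, T.cornerSum s.1 σ = 0 := by
        intro σ
        refine hc (fun σ => T.cornerSum s.1 σ = 0) ?_ σ₀ σ ((h0 σ₀ 0).symm.trans hs)
        intro σ i τ π hg h
        obtain ⟨j, hj⟩ := exists_ne i
        rw [← h0 τ (π j), ← vtx_eq_of_glue hg hj, h0, h]
      ext c
      obtain ⟨τ, j, rfl⟩ := vtx_surjective c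
      exact (h0 τ j).trans (h1 τ)
    simpa using LinearMap.finrank_le_finrank_of_injective hf
  have hrn' := (bd.domRestrict C).finrank_range_add_finrank_ker
  -- The composite of the coboundaries is zero, because each corner of a triangle lies on two of its
  -- edges.
  have hcomp : finrank (ZMod 2) (LinearMap.range cb) ≤
      finrank (ZMod 2) (LinearMap.ker (bd.domRestrict C)) := by
    have hmem : ∀ s, cb s ∈ C := fun s σ i τ π h => cornerSum_sub_glue s h
    have hle : LinearMap.range cb ≤ (LinearMap.ker (bd.domRestrict C)).map C.subtype := by
      rintro _ ⟨s, rfl⟩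
      refine ⟨⟨cb s, hmem s⟩, ?_, rfl⟩
      ext σ
      change ∑ i, (T.cornerSum s σ - s (T.vtx σ i)) = 0
      rw [Finset.sum_sub_distrib, ← cornerSum_apply]
      have h2 : (2 : ZMod 2) = 0 := rfl
      simp only [Finset.sum_const, Finset.card_univ, Fintype.card_fin, nsmul_eq_mul]
      push_cast
      linear_combination T.cornerSum s σ * h2
    refine (Submodule.finrank_mono hle).trans ?_
    rw [LinearEquiv.finrank_eq (Submodule.equivMapOfInjective _ C.subtype_injective _)]
  -- The coboundary of the indicator of an edge is the sum of the basis vectors of its two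
  -- triangles. By strong connectivity these sums, together with one basis vector, span everything.
  have hrange : Fintype.card T.Facet ≤
      finrank (ZMod 2) (LinearMap.range (bd.domRestrict C)) + 1 := by
    let R := LinearMap.range (bd.domRestrict C)
    let L := Submodule.span (ZMod 2) {(Pi.single σ₀ 1 : T.Facet → ZMod 2)}
    have hadj : ∀ σ i τ π, T.glue σ i = some (τ, π) →
        (Pi.single σ 1 + Pi.single τ 1 : T.Facet → ZMod 2) ∈ R := by
      intro σ i τ π hg
      let e : T.Facet × Fin 3 → ZMod 2 := Pi.single (σ, i) 1 + Pi.single (τ, π i) 1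
      have he : e ∈ C := by
        intro σ' i' τ' π' hg'
        have h1 := glue_target_eq_iff hg hg'
        have h1' := glue_target_eq_iff (T.glue_symm _ _ _ _ hg) hg'
        rw [Equiv.symm_apply_apply] at h1'
        simp only [e, Pi.add_apply, Pi.single_apply, h1, h1']
        exact add_comm _ _
      refine ⟨⟨e, he⟩, ?_⟩
      ext ρ
      change ∑ j, e (ρ, j) = _
      simp only [e, Pi.add_apply, Pi.single_apply, Prod.mk.injEq, Finset.sum_add_distrib]
      congr 1
      · by_cases h : ρ = σ <;> simp [h]
      · by_cases h : ρ = τ <;> simp [h]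
    have htop : R ⊔ L = ⊤ := by
      have hs : ∀ σ, (Pi.single σ 1 : T.Facet → ZMod 2) ∈ R ⊔ L := by
        intro σ
        refine hc (fun σ => (Pi.single σ 1 : T.Facet → ZMod 2) ∈ R ⊔ L) ?_ σ₀ σ
          (Submodule.mem_sup_right (Submodule.mem_span_singleton_self _))
        intro σ i τ π hg h
        have h1 := Submodule.sub_mem _ (Submodule.mem_sup_left (T := L) (hadj σ i τ π hg)) h
        simpa using h1
      rw [eq_top_iff]
      intro u _
      rw [pi_eq_sum_univ' u]
      refine Submodule.sum_mem _ fun σ _ => Submodule.smul_mem _ _ ?_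
      convert hs σ using 1
    have h1 := Submodule.finrank_add_le_finrank_add_finrank R L
    rw [htop, finrank_top, finrank_fintype_fun_eq_card] at h1
    have h2 : finrank (ZMod 2) L ≤ 1 := (finrank_span_le_card _).trans (by simp)
    change _ ≤ finrank (ZMod 2) R + 1
    omega
  simp only [numVertices, numFacets, Nat.card_eq_fintype_card]
  omega

end Triangulation

/-! ### Polyhedra given by inequalities, and piecewise affine maps. -/

open Set Filter Topology

section Polytope

variable {E : Type*} [NormedAddCommGroup E] [NormedSpace ℝ E] {κ : Type*}

/-- A polyhedron, given by finitely many affine inequalities. -/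
def polyhedron (ℓ : κ → E →ᵃ[ℝ] ℝ) : Set E := {x | ∀ k, 0 ≤ ℓ k x}

theorem AffineMap.map_add_smul_sub (ℓ : E →ᵃ[ℝ] ℝ) (x y : E) (t : ℝ) :
    ℓ (x + t • (x - y)) = ℓ x + t * (ℓ x - ℓ y) := by
  have h := ℓ.apply_lineMap y x (1 + t)
  have h1 : AffineMap.lineMap y x (1 + t) = x + t • (x - y) := by
    rw [AffineMap.lineMap_apply_module']; module
  rw [h1] at h
  rw [h, AffineMap.lineMap_apply_module']
  simp; ring

/-- An extreme point is determined by the set of inequalities tight at it: if `x` and `y` have the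
same tight set, the segment from `y` to `x` can be prolonged slightly beyond `x`, so extremality of
`x` forces `x = y`. -/
theorem finite_extremePoints_polyhedron [Finite κ] (ℓ : κ → E →ᵃ[ℝ] ℝ) :
    ((polyhedron ℓ).extremePoints ℝ).Finite := by
  refine Set.Finite.of_finite_image (f := fun x => {k | ℓ k x = 0}) (Set.toFinite _) ?_
  intro x hx y hy hxy
  have hxP : x ∈ polyhedron ℓ := hx.1
  have hyP : y ∈ polyhedron ℓ := hy.1
  have hev : ∀ᶠ t in 𝓝[>] (0 : ℝ), ∀ k, 0 ≤ ℓ k (x + t • (x - y)) := by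
    rw [eventually_all]
    intro k
    simp only [AffineMap.map_add_smul_sub]
    by_cases hk : ℓ k x = 0
    · have : ℓ k y = 0 := (Set.ext_iff.1 hxy k).1 hk
      simp [hk, this]
    · have h0 : 0 < ℓ k x := lt_of_le_of_ne (hxP k) (Ne.symm hk)
      have hcont : Continuous fun t : ℝ => ℓ k x + t * (ℓ k x - ℓ k y) := by fun_prop
      exact nhdsWithin_le_nhds ((hcont.tendsto' 0 (ℓ k x) (by simp)).eventually_const_le h0)
  obtain ⟨t, ht, ht0⟩ := (hev.and self_mem_nhdsWithin).exists
  have ht0 : 0 < t := ht0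
  have hseg : x ∈ openSegment ℝ (x + t • (x - y)) y := by
    refine ⟨1 / (1 + t), t / (1 + t), by positivity, by positivity, by field_simp, ?_⟩
    have : (1 : ℝ) + t ≠ 0 := by positivity
    match_scalars
    · field_simp
    · field_simp
      ring
  exact ((mem_extremePoints.1 hx).2 _ ht y hyP hseg).2.symm

variable [FiniteDimensional ℝ E] [Finite κ]

/-- Krein–Milman, together with the finiteness of the set of extreme points. -/
theorem exists_finset_convexHull_eq_polyhedron (ℓ : κ → E →ᵃ[ℝ] ℝ)
    (hb : Bornology.IsBounded (polyhedron ℓ)) :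
    ∃ V : Finset E, convexHull ℝ (V : Set E) = polyhedron ℓ := by
  have hclosed : IsClosed (polyhedron ℓ) := by
    simp only [polyhedron, ofPred_forall]
    exact isClosed_iInter fun k =>
      isClosed_le continuous_const (ℓ k).continuous_of_finiteDimensional
  have := FiniteDimensional.proper_real E
  have hcomp : IsCompact (polyhedron ℓ) := Metric.isCompact_of_isClosed_isBounded hclosed hb
  have hconv : Convex ℝ (polyhedron ℓ) := by
    simp only [polyhedron, ofPred_forall]
    exact convex_iInter fun k => (convex_Ici (0 : ℝ)).affine_preimage (ℓ k)
  have hfin := finite_extremePoints_polyhedron ℓ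
  refine ⟨hfin.toFinset, ?_⟩
  rw [Set.Finite.coe_toFinset, ← (Set.Finite.isClosed_convexHull ℝ hfin).closure_eq,
    closure_convexHull_extremePoints hcomp hconv]

theorem frontier_polyhedron (ℓ : κ → E →ᵃ[ℝ] ℝ) {y₀ : E} (h₀ : ∀ k, 0 < ℓ k y₀) :
    y₀ ∈ interior (polyhedron ℓ) ∧
      frontier (polyhedron ℓ) = {y | y ∈ polyhedron ℓ ∧ ∃ k, ℓ k y = 0} := by
  have hclosed : IsClosed (polyhedron ℓ) := by
    simp only [polyhedron, ofPred_forall]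
    exact isClosed_iInter fun k =>
      isClosed_le continuous_const (ℓ k).continuous_of_finiteDimensional
  have hsub : {y | ∀ k, 0 < ℓ k y} ⊆ interior (polyhedron ℓ) := by
    refine interior_maximal (fun y hy k => (hy k).le) ?_
    simp only [ofPred_forall]
    exact isOpen_iInter_of_finite fun k =>
      isOpen_lt continuous_const (ℓ k).continuous_of_finiteDimensional
  refine ⟨hsub h₀, ?_⟩
  rw [hclosed.frontier_eq]
  ext y
  constructor
  · rintro ⟨hy, hn⟩
    refine ⟨hy, ?_⟩
    by_contra! hk
    exact hn (hsub fun k => lt_of_le_of_ne (hy k) (hk k).symm)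
  · rintro ⟨hy, k, hk⟩
    refine ⟨hy, fun hn => ?_⟩
    -- Moving from `y` away from `y₀` makes the tight inequality fail at once, so `y` is not
    -- interior.
    have hcont : Continuous fun t : ℝ => y + t • (y - y₀) := by fun_prop
    have hev : ∀ᶠ t in 𝓝[>] (0 : ℝ), y + t • (y - y₀) ∈ polyhedron ℓ :=
      nhdsWithin_le_nhds (hcont.tendsto' 0 y (by simp) (mem_interior_iff_mem_nhds.1 hn))
    obtain ⟨t, ht, ht0⟩ := (hev.and self_mem_nhdsWithin).exists
    have ht0 : 0 < t := ht0
    have h1 := ht k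
    rw [AffineMap.map_add_smul_sub, hk] at h1
    have : 0 < t * ℓ k y₀ := mul_pos ht0 (h₀ k)
    linarith

end Polytope

section CellwiseAffine

variable {ι E : Type} [Fintype ι] [AddCommGroup E] [Module ℝ E]

/-- A map from the standard simplex is cellwise affine if it is affine on each cell of some
finite hyperplane arrangement. -/
def IsCellwiseAffine (f : stdSimplex ℝ ι → E) : Prop :=
  ∃ (κ : Type) (_ : Finite κ) (ℓ : κ → (ι → ℝ) →ᵃ[ℝ] ℝ),
    ∀ s : κ → ℤˣ, ∃ A : (ι → ℝ) →ᵃ[ℝ] E,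
      ∀ x : stdSimplex ℝ ι, (∀ k, 0 ≤ ((s k : ℤ) : ℝ) * ℓ k x.1) → f x = A x.1

theorem exists_sign_mul_nonneg (r : ℝ) : ∃ u : ℤˣ, 0 ≤ ((u : ℤ) : ℝ) * r := by
  rcases le_total 0 r with h | h
  · exact ⟨1, by simpa⟩
  · exact ⟨-1, by simpa⟩

theorem isCellwiseAffine_affine (A : (ι → ℝ) →ᵃ[ℝ] E) :
    IsCellwiseAffine fun x : stdSimplex ℝ ι => A x.1 :=
  ⟨Empty, inferInstance, Empty.elim, fun _ => ⟨A, fun _ _ => rfl⟩⟩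

theorem IsCellwiseAffine.comp_affine {ι' : Type} [Fintype ι'] {f : stdSimplex ℝ ι → E}
    (hf : IsCellwiseAffine f) (g : (ι' → ℝ) →ᵃ[ℝ] (ι → ℝ))
    (g' : stdSimplex ℝ ι' → stdSimplex ℝ ι) (hg : ∀ x, (g' x).1 = g x.1) :
    IsCellwiseAffine fun x => f (g' x) := by
  obtain ⟨κ, hκ, ℓ, h⟩ := hf
  refine ⟨κ, hκ, fun k => (ℓ k).comp g, fun s => ?_⟩
  obtain ⟨A, hA⟩ := h s
  exact ⟨A.comp g, fun x hx => by
    change f (g' x) = _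
    rw [hA (g' x) (fun k => by rw [hg]; exact hx k), hg]; rfl⟩

theorem IsCellwiseAffine.toLp {n : ℕ} {f : stdSimplex ℝ ι → EuclideanSpace ℝ (Fin n)}
    (h : ∀ j, IsCellwiseAffine fun x => f x j) : IsCellwiseAffine f := by
  choose κ hκ ℓ h using h
  refine ⟨Σ j, κ j, inferInstance, fun k => ℓ k.1 k.2, fun s => ?_⟩
  choose A hA using fun j => h j fun k => s ⟨j, k⟩
  refine ⟨(WithLp.linearEquiv 2 ℝ (Fin n → ℝ)).symm.toLinearMap.toAffineMap.comp
    (AffineMap.pi A), fun x hx => ?_⟩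
  ext j
  exact hA j x fun k => hx ⟨j, k⟩

theorem IsCellwiseAffine.add {f g : stdSimplex ℝ ι → E} (hf : IsCellwiseAffine f)
    (hg : IsCellwiseAffine g) : IsCellwiseAffine fun x => f x + g x := by
  obtain ⟨κ, hκ, ℓ, hf⟩ := hf
  obtain ⟨κ', hκ', ℓ', hg⟩ := hg
  refine ⟨κ ⊕ κ', inferInstance, Sum.elim ℓ ℓ', fun s => ?_⟩
  obtain ⟨A, hA⟩ := hf fun k => s (Sum.inl k)
  obtain ⟨B, hB⟩ := hg fun k => s (Sum.inr k)
  refine ⟨A + B, fun x hx => ?_⟩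
  change f x + g x = _
  rw [hA x fun k => hx (Sum.inl k), hB x fun k => hx (Sum.inr k)]
  rfl

theorem IsCellwiseAffine.const_smul {f : stdSimplex ℝ ι → E} (hf : IsCellwiseAffine f) (c : ℝ) :
    IsCellwiseAffine fun x => c • f x := by
  obtain ⟨κ, hκ, ℓ, hf⟩ := hf
  refine ⟨κ, inferInstance, ℓ, fun s => ?_⟩
  obtain ⟨A, hA⟩ := hf s
  refine ⟨c • A, fun x hx => ?_⟩
  change c • f x = _
  rw [hA x hx]
  rfl

/-- Refine both arrangements by the hyperplanes on which an affine piece of `f` equals an affine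
piece of `g`; on each new cell one function dominates. -/
theorem IsCellwiseAffine.max {f g : stdSimplex ℝ ι → ℝ} (hf : IsCellwiseAffine f)
    (hg : IsCellwiseAffine g) : IsCellwiseAffine fun x => max (f x) (g x) := by
  obtain ⟨κ, hκ, ℓ, hf⟩ := hf
  obtain ⟨κ', hκ', ℓ', hg⟩ := hg
  choose A hA using hf
  choose B hB using hg
  refine ⟨(κ ⊕ κ') ⊕ ((κ → ℤˣ) × (κ' → ℤˣ)), inferInstance,
    Sum.elim (Sum.elim ℓ ℓ') fun p => A p.1 - B p.2, fun s => ?_⟩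
  let s₁ : κ → ℤˣ := fun k => s (Sum.inl (Sum.inl k))
  let s₂ : κ' → ℤˣ := fun k => s (Sum.inl (Sum.inr k))
  rcases Int.units_eq_one_or (s (Sum.inr (s₁, s₂))) with h | h
  · refine ⟨A s₁, fun x hx => ?_⟩
    have h1 := hx (Sum.inr (s₁, s₂))
    rw [h] at h1
    have h2 : B s₂ x.1 ≤ A s₁ x.1 := by simpa using h1
    change Max.max (f x) (g x) = _
    rw [hA s₁ x fun k => hx (Sum.inl (Sum.inl k)), hB s₂ x fun k => hx (Sum.inl (Sum.inr k)),
      max_eq_left h2]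
  · refine ⟨B s₂, fun x hx => ?_⟩
    have h1 := hx (Sum.inr (s₁, s₂))
    rw [h] at h1
    have h2 : A s₁ x.1 ≤ B s₂ x.1 := by simpa using h1
    change Max.max (f x) (g x) = _
    rw [hA s₁ x fun k => hx (Sum.inl (Sum.inl k)), hB s₂ x fun k => hx (Sum.inl (Sum.inr k)),
      max_eq_right h2]

theorem IsCellwiseAffine.min {f g : stdSimplex ℝ ι → ℝ} (hf : IsCellwiseAffine f)
    (hg : IsCellwiseAffine g) : IsCellwiseAffine fun x => min (f x) (g x) := by
  have h := ((hf.const_smul (-1)).max (hg.const_smul (-1))).const_smul (-1)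
  convert h using 2 with x
  simp only [smul_eq_mul, neg_mul, one_mul, max_neg_neg, neg_neg]

/-- The closed cells of the arrangement cut the simplex into bounded polyhedra, which are convex
hulls of finite sets. -/
theorem IsCellwiseAffine.isPiecewiseAffine {f : stdSimplex ℝ ι → E} (hf : IsCellwiseAffine f) :
    IsPiecewiseAffine f := by
  classical
  obtain ⟨κ, hκ, ℓ, h⟩ := hf
  let sumA : (ι → ℝ) →ᵃ[ℝ] ℝ :=
    (∑ i, LinearMap.proj i : (ι → ℝ) →ₗ[ℝ] ℝ).toAffineMap - AffineMap.const ℝ _ 1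
  -- The last summand encodes the equation `∑ x i = 1` as two opposite inequalities.
  let L : (κ → ℤˣ) → κ ⊕ ι ⊕ ℤˣ → (ι → ℝ) →ᵃ[ℝ] ℝ := fun s =>
    Sum.elim (fun k => ((s k : ℤ) : ℝ) • ℓ k)
      (Sum.elim (fun i => (LinearMap.proj i : (ι → ℝ) →ₗ[ℝ] ℝ).toAffineMap)
        (fun u => ((u : ℤ) : ℝ) • sumA))
  have hL : ∀ s x, x ∈ polyhedron (L s) ↔
      x ∈ stdSimplex ℝ ι ∧ ∀ k, 0 ≤ ((s k : ℤ) : ℝ) * ℓ k x := by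
    intro s x
    have hs : ∀ u : ℤˣ, L s (Sum.inr (Sum.inr u)) x = ((u : ℤ) : ℝ) * (∑ i, x i - 1) := by
      intro u
      simp [L, sumA]
    constructor
    · intro hx
      refine ⟨⟨fun i => hx (Sum.inr (Sum.inl i)), ?_⟩, fun k => hx (Sum.inl k)⟩
      have h1 := hx (Sum.inr (Sum.inr 1))
      have h2 := hx (Sum.inr (Sum.inr (-1)))
      rw [hs] at h1 h2
      simp at h1 h2
      linarith
    · rintro ⟨⟨hx0, hx1⟩, hx⟩ (k | i | u)
      · exact hx k
      · exact hx0 i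
      · rw [hs, hx1]
        simp
  have hV : ∀ s, ∃ V : Finset (ι → ℝ), convexHull ℝ (V : Set (ι → ℝ)) = polyhedron (L s) := by
    intro s
    refine exists_finset_convexHull_eq_polyhedron _ ((bounded_stdSimplex ι).subset ?_)
    exact fun x hx => ((hL s x).1 hx).1
  choose V hV using hV
  have : Fintype (κ → ℤˣ) := Fintype.ofFinite _
  let e := (Fintype.equivFin (κ → ℤˣ)).symm
  refine ⟨_, fun k => V (e k), ?_, fun k => ?_⟩
  · ext x
    simp only [mem_iUnion, hV, hL]
    constructor
    · intro hx
      choose s hs using fun k => exists_sign_mul_nonneg (ℓ k x)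
      exact ⟨e.symm s, hx, by simpa using hs⟩
    · rintro ⟨_, hx, _⟩
      exact hx
  · obtain ⟨A, hA⟩ := h (e k)
    refine ⟨A, fun x hx => hA x ?_⟩
    rw [hV, hL] at hx
    exact hx.2

end CellwiseAffine

/-! ### A criterion for triangulating the sphere. -/

namespace Triangulation

variable {d : ℕ} {T : Triangulation d}

instance : CompactSpace T.Realization := by
  have := T.finite_facet
  exact inferInstanceAs (CompactSpace (Quot T.PointRel))

theorem facetMap_eq_of_glue {σ τ : T.Facet} {i : Fin (d + 1)} {π : Equiv.Perm (Fin (d + 1))}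
    (h : T.glue σ i = some (τ, π)) {x y : stdSimplex ℝ (Fin (d + 1))} (hx : x.1 i = 0)
    (hy : ∀ j, y.1 (π j) = x.1 j) : T.facetMap σ x = T.facetMap τ y :=
  Quot.sound ⟨i, π, h, hx, hy⟩

/-- A facetwise cellwise affine parametrization of the boundary of a polytope, injective up to the
gluings, exhibits a triangulation of the sphere. -/
theorem IsClosed.isOfSphere (hT : T.IsClosed) {κ : Type} [Finite κ]
    (ℓ : κ → EuclideanSpace ℝ (Fin (d + 1)) →ᵃ[ℝ] ℝ)
    (hb : Bornology.IsBounded (polyhedron ℓ)) {y₀ : EuclideanSpace ℝ (Fin (d + 1))}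
    (h₀ : ∀ k, 0 < ℓ k y₀)
    (F : T.Facet → stdSimplex ℝ (Fin (d + 1)) → EuclideanSpace ℝ (Fin (d + 1)))
    (hF : ∀ σ, IsCellwiseAffine (F σ)) (hcont : ∀ σ, Continuous (F σ))
    (hglue : ∀ σ i τ π, T.glue σ i = some (τ, π) → ∀ x y : stdSimplex ℝ (Fin (d + 1)),
      x.1 i = 0 → (∀ j, y.1 (π j) = x.1 j) → F σ x = F τ y)
    (hmem : ∀ σ x, F σ x ∈ polyhedron ℓ ∧ ∃ k, ℓ k (F σ x) = 0)
    (hsurj : ∀ y ∈ polyhedron ℓ, (∃ k, ℓ k y = 0) → ∃ σ x, F σ x = y)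
    (hinj : ∀ σ x τ y, F σ x = F τ y → T.facetMap σ x = T.facetMap τ y) :
    T.IsOfSphere := by
  obtain ⟨V, hV⟩ := exists_finset_convexHull_eq_polyhedron ℓ hb
  obtain ⟨hint, hfr⟩ := frontier_polyhedron ℓ h₀
  refine ⟨hT, V, ⟨y₀, by rwa [hV]⟩, ?_⟩
  rw [hV, hfr]
  let G : T.Realization → {y | y ∈ polyhedron ℓ ∧ ∃ k, ℓ k y = 0} :=
    Quot.lift (fun p => ⟨F p.1 p.2, hmem p.1 p.2⟩) (by
      rintro p q ⟨i, π, hg, hx, hy⟩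
      exact Subtype.ext (hglue _ _ _ _ hg _ _ hx hy))
  have hGc : Continuous G := by
    refine continuous_quot_lift _ ?_
    refine Continuous.subtype_mk ?_ _
    rw [continuous_sigma_iff]
    exact hcont
  have hGb : Function.Bijective G := by
    constructor
    · intro p q h
      induction p using Quot.ind with
      | mk p =>
        induction q using Quot.ind with
        | mk q => exact hinj _ _ _ _ (congrArg Subtype.val h)
    · rintro ⟨y, hy, hk⟩
      obtain ⟨σ, x, h⟩ := hsurj y hy hk
      exact ⟨T.facetMap σ x, Subtype.ext h⟩
  refine ⟨hGc.homeoOfEquivCompactToT2 (f := Equiv.ofBijective G hGb), fun σ => ?_⟩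
  exact (hF σ).isPiecewiseAffine

end Triangulation

/-! ### Subdividing an edge of a simplex. -/

open Equiv

/-- A point of the standard simplex, with permuted coordinates. -/
def stdSimplex.permute {ι : Type*} [Fintype ι] (π : Perm ι) (x : stdSimplex ℝ ι) :
    stdSimplex ℝ ι :=
  ⟨fun j => x.1 (π j), fun _ => x.2.1 _, (Equiv.sum_comp π x.1).trans x.2.2⟩

section EdgeSubdivision

variable {e : ℕ}

/-- Subdividing the edge `01` of a simplex into `k` equal parts subdivides the simplex into `k`
simplices; this is the inclusion of the simplex number `i`. -/
noncomputable def edgeSubdiv (k i : ℕ) : (Fin (e + 2) → ℝ) →ₗ[ℝ] (Fin (e + 2) → ℝ) where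
  toFun x j := if j = 0 then ((k - i) * x 0 + (k - i - 1) * x 1) / k
    else if j = 1 then (i * x 0 + (i + 1) * x 1) / k else x j
  map_add' x y := by ext j; dsimp only [Pi.add_apply]; split_ifs <;> ring
  map_smul' a x := by
    ext j; dsimp only [Pi.smul_apply, smul_eq_mul, RingHom.id_apply]; split_ifs <;> ring

theorem edgeSubdiv_zero (k i : ℕ) (x : Fin (e + 2) → ℝ) :
    edgeSubdiv k i x 0 = ((k - i) * x 0 + (k - i - 1) * x 1) / k := rfl

theorem edgeSubdiv_one (k i : ℕ) (x : Fin (e + 2) → ℝ) :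
    edgeSubdiv k i x 1 = (i * x 0 + (i + 1) * x 1) / k := rfl

theorem edgeSubdiv_of_ne (k i : ℕ) (x : Fin (e + 2) → ℝ) {j : Fin (e + 2)} (h0 : j ≠ 0)
    (h1 : j ≠ 1) : edgeSubdiv k i x j = x j := by
  change (if j = 0 then _ else if j = 1 then _ else _) = _
  rw [if_neg h0, if_neg h1]

theorem sum_eq_add_add (x : Fin (e + 2) → ℝ) :
    ∑ j, x j = x 0 + x 1 + ∑ j : Fin e, x j.succ.succ := by
  rw [Fin.sum_univ_succ, Fin.sum_univ_succ, ← add_assoc]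
  rfl

theorem ext_edge {x y : Fin (e + 2) → ℝ} (h0 : x 0 = y 0) (h1 : x 1 = y 1)
    (h : ∀ j, j ≠ 0 → j ≠ 1 → x j = y j) : x = y := by
  ext j
  by_cases hj0 : j = 0
  · rw [hj0, h0]
  · by_cases hj1 : j = 1
    · rw [hj1, h1]
    · exact h j hj0 hj1

theorem edgeSubdiv_mem {k i : ℕ} (hi : i < k) {x : Fin (e + 2) → ℝ}
    (hx : x ∈ stdSimplex ℝ (Fin (e + 2))) : edgeSubdiv k i x ∈ stdSimplex ℝ (Fin (e + 2)) := by
  have hk : (i : ℝ) + 1 ≤ k := by exact_mod_cast hi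
  have hi0 : (0 : ℝ) ≤ i := Nat.cast_nonneg i
  have hk0 : (0 : ℝ) < k := by linarith
  refine ⟨fun j => ?_, ?_⟩
  · by_cases hj0 : j = 0
    · rw [hj0, edgeSubdiv_zero]
      exact div_nonneg (add_nonneg (mul_nonneg (by linarith) (hx.1 0))
        (mul_nonneg (by linarith) (hx.1 1))) hk0.le
    · by_cases hj1 : j = 1
      · rw [hj1, edgeSubdiv_one]
        exact div_nonneg (add_nonneg (mul_nonneg hi0 (hx.1 0))
          (mul_nonneg (by linarith) (hx.1 1))) hk0.le
      · rw [edgeSubdiv_of_ne k i x hj0 hj1]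
        exact hx.1 j
  · rw [← hx.2, sum_eq_add_add, sum_eq_add_add x, edgeSubdiv_zero, edgeSubdiv_one]
    congr 1
    field_simp
    ring

/-- The inclusion of the simplex number `i` of the subdivision, as a map of simplices. -/
noncomputable def edgeSubdivSimplex {k : ℕ} (i : Fin k) (x : stdSimplex ℝ (Fin (e + 2))) :
    stdSimplex ℝ (Fin (e + 2)) :=
  ⟨edgeSubdiv k i x.1, edgeSubdiv_mem i.2 x.2⟩

theorem continuous_edgeSubdivSimplex {k : ℕ} (i : Fin k) :
    Continuous (edgeSubdivSimplex (e := e) i) :=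
  Continuous.subtype_mk
    ((LinearMap.continuous_of_finiteDimensional _).comp continuous_subtype_val) _

theorem IsCellwiseAffine.comp_edgeSubdivSimplex {E : Type} [AddCommGroup E] [Module ℝ E]
    {f : stdSimplex ℝ (Fin (e + 2)) → E} (hf : IsCellwiseAffine f) {k : ℕ} (i : Fin k) :
    IsCellwiseAffine fun x => f (edgeSubdivSimplex i x) :=
  hf.comp_affine (edgeSubdiv k i).toAffineMap _ fun _ => rfl

theorem edgeSubdivSimplex_injective {k : ℕ} (i : Fin k) :
    Function.Injective (edgeSubdivSimplex (e := e) i) := by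
  intro x y h
  have hk : (0 : ℝ) < k := by exact_mod_cast i.pos
  have h' : ∀ j, edgeSubdiv k i x.1 j = edgeSubdiv k i y.1 j :=
    fun j => congrFun (congrArg Subtype.val h) j
  have h0 := h' 0
  have h1 := h' 1
  rw [edgeSubdiv_zero, edgeSubdiv_zero, div_left_inj' hk.ne'] at h0
  rw [edgeSubdiv_one, edgeSubdiv_one, div_left_inj' hk.ne'] at h1
  have hs : x.1 0 + x.1 1 = y.1 0 + y.1 1 := by
    apply mul_left_cancel₀ hk.ne'
    linear_combination h0 + h1
  have hx1 : x.1 1 = y.1 1 := by linear_combination h1 - (i : ℝ) * hs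
  refine Subtype.ext (ext_edge (by linarith) hx1 fun j hj0 hj1 => ?_)
  simpa only [edgeSubdiv_of_ne k _ _ hj0 hj1] using h' j

/-- Consecutive simplices of the subdivision share a ridge. -/
theorem edgeSubdivSimplex_permute_swap {k : ℕ} {i j : Fin k} (hij : (j : ℕ) = i + 1)
    {x : stdSimplex ℝ (Fin (e + 2))} (hx : x.1 0 = 0) :
    edgeSubdivSimplex j (stdSimplex.permute (swap 0 1) x) = edgeSubdivSimplex i x := by
  have hj : (j : ℝ) = i + 1 := by exact_mod_cast hij
  refine Subtype.ext (ext_edge ?_ ?_ fun l hl0 hl1 => ?_)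
  · change edgeSubdiv k j _ 0 = edgeSubdiv k i x.1 0
    simp only [edgeSubdiv_zero, stdSimplex.permute, swap_apply_left, swap_apply_right, hx, hj]
    ring
  · change edgeSubdiv k j _ 1 = edgeSubdiv k i x.1 1
    simp only [edgeSubdiv_one, stdSimplex.permute, swap_apply_left, swap_apply_right, hx, hj]
    ring
  · change edgeSubdiv k j _ l = edgeSubdiv k i x.1 l
    simp only [edgeSubdiv_of_ne _ _ _ hl0 hl1, stdSimplex.permute, swap_apply_of_ne_of_ne hl0 hl1]

/-- With `s = x 0 + x 1`, which is also `y 0 + y 1`, the coordinate 1 of the image times `k` is `(i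
+ 1) s - x 0` on one side and at least `j s` on the other, while `i + 1 ≤ j`. -/
theorem eq_zero_of_edgeSubdivSimplex_eq {k : ℕ} {i j : Fin k} (hij : i < j)
    {x y : stdSimplex ℝ (Fin (e + 2))} (h : edgeSubdivSimplex i x = edgeSubdivSimplex j y) :
    x.1 0 = 0 := by
  have hk : (0 : ℝ) < k := by exact_mod_cast i.pos
  have h' : ∀ l, edgeSubdiv k i x.1 l = edgeSubdiv k j y.1 l :=
    fun l => congrFun (congrArg Subtype.val h) l
  have h0 := h' 0
  have h1 := h' 1
  rw [edgeSubdiv_zero, edgeSubdiv_zero, div_left_inj' hk.ne'] at h0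
  rw [edgeSubdiv_one, edgeSubdiv_one, div_left_inj' hk.ne'] at h1
  have hs : x.1 0 + x.1 1 = y.1 0 + y.1 1 := by
    apply mul_left_cancel₀ hk.ne'
    linear_combination h0 + h1
  have hij' : (i : ℝ) + 1 ≤ j := by exact_mod_cast hij
  have hx0 := x.2.1 0
  have hx1 := x.2.1 1
  have hy1 := y.2.1 1
  have h2 : ((i : ℝ) + 1) * (x.1 0 + x.1 1) ≤ j * (x.1 0 + x.1 1) :=
    mul_le_mul_of_nonneg_right hij' (by linarith)
  have h3 : (j : ℝ) * (x.1 0 + x.1 1) = j * (y.1 0 + y.1 1) := by rw [hs]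
  linarith

/-- The simplices of the subdivision cover. -/
theorem exists_edgeSubdivSimplex_eq {k : ℕ} (hk : 0 < k) (z : stdSimplex ℝ (Fin (e + 2))) :
    ∃ (i : Fin k) (x : stdSimplex ℝ (Fin (e + 2))), edgeSubdivSimplex i x = z := by
  have hk0 : (0 : ℝ) < k := by exact_mod_cast hk
  have hz0 := z.2.1 0
  have hz1 := z.2.1 1
  -- Locates the piece containing `z` without dividing by `z 0 + z 1`, which may vanish.
  have key : ∀ m : ℕ, k * z.1 1 ≤ (m + 1) * (z.1 0 + z.1 1) → ∃ i ≤ m,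
      (i : ℝ) * (z.1 0 + z.1 1) ≤ k * z.1 1 ∧ k * z.1 1 ≤ (i + 1) * (z.1 0 + z.1 1) := by
    intro m
    induction m with
    | zero =>
      intro h
      exact ⟨0, le_rfl, by simpa using mul_nonneg hk0.le hz1, by simpa using h⟩
    | succ m ih =>
      intro h
      rcases le_total (k * z.1 1) ((m + 1) * (z.1 0 + z.1 1)) with h1 | h1
      · obtain ⟨i, hi, h2⟩ := ih h1
        exact ⟨i, by omega, h2⟩
      · exact ⟨m + 1, le_rfl, by push_cast; exact h1, h⟩
  obtain ⟨k, rfl⟩ : ∃ l, k = l + 1 := ⟨k - 1, by omega⟩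
  obtain ⟨i, hi, h1, h2⟩ := key k (by
    push_cast
    have : (0 : ℝ) ≤ (k + 1) * z.1 0 := mul_nonneg (by positivity) hz0
    linarith)
  -- The solution of the linear system `edgeSubdiv (k + 1) i x = z`.
  let x : Fin (e + 2) → ℝ := fun j =>
    if j = 0 then (i + 1) * (z.1 0 + z.1 1) - (k + 1 : ℕ) * z.1 1
    else if j = 1 then (k + 1 : ℕ) * z.1 1 - i * (z.1 0 + z.1 1) else z.1 j
  have hx0 : x 0 = (i + 1) * (z.1 0 + z.1 1) - (k + 1 : ℕ) * z.1 1 := rfl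
  have hx1 : x 1 = (k + 1 : ℕ) * z.1 1 - i * (z.1 0 + z.1 1) := rfl
  have hx2 : ∀ j, j ≠ 0 → j ≠ 1 → x j = z.1 j := fun j h0 h1 => by simp [x, h0, h1]
  have hx : x ∈ stdSimplex ℝ (Fin (e + 2)) := by
    refine ⟨fun j => ?_, ?_⟩
    · by_cases hj0 : j = 0
      · rw [hj0, hx0]; linarith
      · by_cases hj1 : j = 1
        · rw [hj1, hx1]; linarith
        · rw [hx2 j hj0 hj1]; exact z.2.1 j
    · rw [← z.2.2, sum_eq_add_add, sum_eq_add_add z.1, hx0, hx1]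
      congr 1
      ring
  refine ⟨⟨i, by omega⟩, ⟨x, hx⟩, Subtype.ext (ext_edge ?_ ?_ fun j hj0 hj1 => ?_)⟩
  · change edgeSubdiv (k + 1) i x 0 = _
    rw [edgeSubdiv_zero, hx0, hx1]
    field_simp
    ring
  · change edgeSubdiv (k + 1) i x 1 = _
    rw [edgeSubdiv_one, hx0, hx1]
    field_simp
    ring
  · change edgeSubdiv (k + 1) i x j = _
    rw [edgeSubdiv_of_ne _ _ _ hj0 hj1, hx2 j hj0 hj1]

theorem edgeSubdivSimplex_last {k : ℕ} {z : stdSimplex ℝ (Fin (e + 2))} (hz : z.1 0 = 0) :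
    edgeSubdivSimplex (Fin.last k) z = z := by
  refine Subtype.ext (ext_edge ?_ ?_ fun j hj0 hj1 => edgeSubdiv_of_ne _ _ _ hj0 hj1)
  · change edgeSubdiv (k + 1) k z.1 0 = _
    rw [edgeSubdiv_zero, hz]
    simp
  · change edgeSubdiv (k + 1) k z.1 1 = _
    rw [edgeSubdiv_one, hz]
    push_cast
    field_simp
    ring

theorem edgeSubdivSimplex_first {k : ℕ} {z : stdSimplex ℝ (Fin (e + 2))} (hz : z.1 1 = 0) :
    edgeSubdivSimplex (0 : Fin (k + 1)) z = z := by
  refine Subtype.ext (ext_edge ?_ ?_ fun j hj0 hj1 => edgeSubdiv_of_ne _ _ _ hj0 hj1)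
  · change edgeSubdiv (k + 1) 0 z.1 0 = _
    rw [edgeSubdiv_zero, hz]
    push_cast
    field_simp
    ring
  · change edgeSubdiv (k + 1) 0 z.1 1 = _
    rw [edgeSubdiv_one, hz]
    simp

/-- A point common to two distinct pieces lies on the ridge of the lower piece facing the next one,
so it can be passed through the gluings one piece at a time. -/
theorem Triangulation.facetMap_eq_of_edgeSubdivSimplex_eq {T : Triangulation (e + 1)} {k : ℕ}
    (φ : Fin k → T.Facet)
    (hφ : ∀ i j : Fin k, (j : ℕ) = i + 1 → T.glue (φ i) 0 = some (φ j, swap 0 1))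
    {i j : Fin k} {x y : stdSimplex ℝ (Fin (e + 2))}
    (h : edgeSubdivSimplex i x = edgeSubdivSimplex j y) :
    T.facetMap (φ i) x = T.facetMap (φ j) y := by
  have key : ∀ (n : ℕ) (i j : Fin k) (x y : stdSimplex ℝ (Fin (e + 2))), (j : ℕ) = i + n →
      edgeSubdivSimplex i x = edgeSubdivSimplex j y →
      T.facetMap (φ i) x = T.facetMap (φ j) y := by
    intro n
    induction n with
    | zero =>
      intro i j x y hij h
      obtain rfl : j = i := Fin.ext hij
      rw [edgeSubdivSimplex_injective j h]
    | succ n ih =>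
      intro i j x y hij h
      have hx := eq_zero_of_edgeSubdivSimplex_eq (Fin.lt_def.2 (by omega)) h
      let i' : Fin k := ⟨i + 1, by omega⟩
      rw [facetMap_eq_of_glue (hφ i i' rfl) hx (y := stdSimplex.permute (swap 0 1) x)
        (fun l => by simp [stdSimplex.permute])]
      refine ih i' j _ y (by simp only [i']; omega) ?_
      rw [edgeSubdivSimplex_permute_swap rfl hx, h]
  rcases le_total i j with hij | hij
  · exact key (j - i) i j x y (by have := Fin.le_def.1 hij; omega) h
  · exact (key (i - j) j i y x (by have := Fin.le_def.1 hij; omega) h.symm).symm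

end EdgeSubdivision

/-- Counts vertices by a labelling of corners that is constant on vertex classes and separates them.
-/
theorem Triangulation.numVertices_eq_of_label {d : ℕ} {T : Triangulation d} {N : ℕ}
    (v : T.Facet → Fin (d + 1) → ℕ)
    (hglue : ∀ σ i τ π, T.glue σ i = some (τ, π) → ∀ j, j ≠ i → v τ (π j) = v σ j)
    (hlt : ∀ σ j, v σ j < N) (hsurj : ∀ m < N, ∃ σ j, v σ j = m)
    (hinj : ∀ σ j τ l, v σ j = v τ l → T.vtx σ j = T.vtx τ l) : T.numVertices = N := by
  let f : Quot T.VertexRel → Fin N := Quot.lift (fun p => ⟨v p.1 p.2, hlt _ _⟩) (by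
    rintro ⟨σ, j⟩ ⟨τ, l⟩ ⟨i, π, hg, hj, rfl⟩
    exact Fin.ext (hglue σ i τ π hg j hj).symm)
  have hf : Function.Bijective f := by
    constructor
    · intro a b h
      obtain ⟨σ, j, rfl⟩ := vtx_surjective a
      obtain ⟨τ, l, rfl⟩ := vtx_surjective b
      exact hinj σ j τ l (congrArg Fin.val h)
    · intro m
      obtain ⟨σ, j, h⟩ := hsurj m m.2
      exact ⟨T.vtx σ j, Fin.ext h⟩
  rw [numVertices, Nat.card_eq_of_bijective f hf, Nat.card_eq_fintype_card, Fintype.card_fin]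

theorem EuclideanSpace.isBounded_of_abs_le_one {n : ℕ} {S : Set (EuclideanSpace ℝ (Fin n))}
    (h : ∀ y ∈ S, ∀ j, |y j| ≤ 1) : Bornology.IsBounded S := by
  rw [isBounded_iff_forall_norm_le]
  refine ⟨√n, fun y hy => ?_⟩
  rw [EuclideanSpace.norm_eq]
  refine Real.sqrt_le_sqrt ?_
  calc ∑ i, ‖y i‖ ^ 2 ≤ ∑ _i : Fin n, (1 : ℝ) := by
        refine Finset.sum_le_sum fun i _ => ?_
        rw [Real.norm_eq_abs]
        exact pow_le_one₀ (abs_nonneg _) (h y hy i)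
    _ = n := by simp

/-! ### The doubled simplex: combinatorics. -/

section DoubledSimplex

/-- The gluings of the double of a `(e + 1)`-simplex, whose edge `01` is subdivided into `k + 1`
parts. -/
def doubledSimplexGlue (e k : ℕ) (p : Bool × Fin (k + 1)) (j : Fin (e + 2)) :
    Option ((Bool × Fin (k + 1)) × Perm (Fin (e + 2))) :=
  if h : j = 0 ∧ (p.2 : ℕ) < k then some ((p.1, ⟨p.2 + 1, by omega⟩), swap 0 1)
  else if j = 1 ∧ 0 < (p.2 : ℕ) then some ((p.1, ⟨p.2 - 1, by omega⟩), swap 0 1)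
  else some ((!p.1, p.2), 1)

theorem doubledSimplexGlue_eq_some_iff {e k : ℕ} {p q : Bool × Fin (k + 1)} {j : Fin (e + 2)}
    {π : Perm (Fin (e + 2))} : doubledSimplexGlue e k p j = some (q, π) ↔
      (j = 0 ∧ q.1 = p.1 ∧ (q.2 : ℕ) = p.2 + 1 ∧ π = swap 0 1) ∨
      (j = 1 ∧ q.1 = p.1 ∧ (p.2 : ℕ) = q.2 + 1 ∧ π = swap 0 1) ∨
      (¬ (j = 0 ∧ (p.2 : ℕ) < k) ∧ ¬ (j = 1 ∧ 0 < (p.2 : ℕ)) ∧ q = (!p.1, p.2) ∧ π = 1) := by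
  obtain ⟨ε, i⟩ := p
  obtain ⟨δ, l⟩ := q
  have h01 : (0 : Fin (e + 2)) ≠ 1 := by simp
  rw [doubledSimplexGlue]
  have hi := i.2
  have hl := l.2
  split_ifs with h1 h2
  · obtain ⟨rfl, h1⟩ := h1
    simp only [Option.some.injEq, Prod.mk.injEq, Fin.ext_iff, h01]
    grind
  · obtain ⟨rfl, h2⟩ := h2
    simp only [Option.some.injEq, Prod.mk.injEq, Fin.ext_iff]
    grind
  · simp only [Option.some.injEq, Prod.mk.injEq, Fin.ext_iff]
    grind

/-- The double of a `(e + 1)`-simplex, whose edge `01` is subdivided into `k + 1` parts. -/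
abbrev doubledSimplex (e k : ℕ) : Triangulation (e + 1) where
  Facet := Bool × Fin (k + 1)
  finite_facet := inferInstance
  glue := doubledSimplexGlue e k
  glue_symm := by
    intro p j q π h
    rw [doubledSimplexGlue_eq_some_iff] at h ⊢
    rcases h with ⟨rfl, h1, h2, rfl⟩ | ⟨rfl, h1, h2, rfl⟩ | ⟨h1, h2, rfl, rfl⟩
    · exact Or.inr (Or.inl ⟨by simp, h1.symm, h2, by simp⟩)
    · exact Or.inl ⟨by simp, h1.symm, h2, by simp⟩
    · exact Or.inr (Or.inr ⟨h1, h2, by simp, rfl⟩)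
  glue_ne_self := by
    intro p j q π h
    rw [doubledSimplexGlue_eq_some_iff] at h
    rcases h with ⟨rfl, h1, h2, rfl⟩ | ⟨rfl, h1, h2, rfl⟩ | ⟨h1, h2, rfl, rfl⟩
    · simp
    · simp
    · simp [Prod.ext_iff]

namespace doubledSimplex

variable {e k : ℕ}

theorem glue_eq_some_iff {p q : (doubledSimplex e k).Facet} {j : Fin (e + 2)}
    {π : Perm (Fin (e + 2))} : (doubledSimplex e k).glue p j = some (q, π) ↔
      (j = 0 ∧ q.1 = p.1 ∧ (q.2 : ℕ) = p.2 + 1 ∧ π = swap 0 1) ∨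
      (j = 1 ∧ q.1 = p.1 ∧ (p.2 : ℕ) = q.2 + 1 ∧ π = swap 0 1) ∨
      (¬ (j = 0 ∧ (p.2 : ℕ) < k) ∧ ¬ (j = 1 ∧ 0 < (p.2 : ℕ)) ∧ q = (!p.1, p.2) ∧ π = 1) :=
  doubledSimplexGlue_eq_some_iff

theorem isClosed : (doubledSimplex e k).IsClosed := by
  intro p j
  change doubledSimplexGlue e k p j ≠ none
  unfold doubledSimplexGlue
  split_ifs <;> simp

theorem glue_succ (ε : Bool) (i j : Fin (k + 1)) (h : (j : ℕ) = i + 1) :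
    (doubledSimplex e k).glue (ε, i) 0 = some ((ε, j), swap 0 1) :=
  glue_eq_some_iff.2 (Or.inl ⟨rfl, rfl, h, rfl⟩)

theorem glue_other (ε : Bool) (i : Fin (k + 1)) {j : Fin (e + 2)} (h0 : ¬ (j = 0 ∧ (i : ℕ) < k))
    (h1 : ¬ (j = 1 ∧ 0 < (i : ℕ))) :
    (doubledSimplex e k).glue (ε, i) j = some ((!ε, i), 1) :=
  glue_eq_some_iff.2 (Or.inr (Or.inr ⟨h0, h1, rfl, rfl⟩))

theorem numFacets : (doubledSimplex e k).numFacets = 2 * (k + 1) := by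
  change Nat.card (Bool × Fin (k + 1)) = _
  simp

/-- A corner is shared by both copies if it lies on a ridge glued across. For corners 0 and 1 the
ridge opposite corner 2 serves, whence `0 < e`. The others lie on the outer ridge of the first
piece, and from there the identification passes along the pieces. -/
theorem vtx_true (he : 0 < e) (ε : Bool) (i : Fin (k + 1)) (j : Fin (e + 2)) :
    (doubledSimplex e k).vtx (ε, i) j = (doubledSimplex e k).vtx (true, i) j := by
  have h01 : (0 : Fin (e + 2)) ≠ 1 := by simp
  have hflip : ∀ (i : Fin (k + 1)) (j l : Fin (e + 2)), j ≠ l → ¬ (l = 0 ∧ (i : ℕ) < k) →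
      ¬ (l = 1 ∧ 0 < (i : ℕ)) →
      (doubledSimplex e k).vtx (ε, i) j = (doubledSimplex e k).vtx (true, i) j := by
    intro i j l hj h0 h1
    cases ε
    · exact Triangulation.vtx_eq_of_glue (glue_other false i h0 h1) hj
    · rfl
  by_cases hj : j = 0 ∨ j = 1
  · let l : Fin (e + 2) := ⟨2, by omega⟩
    have hl0 : l ≠ 0 := by simp [l, Fin.ext_iff]
    have hl1 : l ≠ 1 := by simp [l, Fin.ext_iff]
    refine hflip i j l ?_ (fun h => hl0 h.1) (fun h => hl1 h.1)
    rcases hj with rfl | rfl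
    · exact hl0.symm
    · exact hl1.symm
  · push Not at hj
    induction i using Fin.induction with
    | zero => exact hflip 0 j 1 hj.2 (fun h => h01 h.1.symm) (by simp)
    | succ i ih =>
      have h : ∀ δ, (doubledSimplex e k).vtx (δ, i.castSucc) j =
          (doubledSimplex e k).vtx (δ, i.succ) j := by
        intro δ
        rw [Triangulation.vtx_eq_of_glue (glue_succ δ i.castSucc i.succ (by simp)) hj.1,
          swap_apply_of_ne_of_ne hj.1 hj.2]
      rw [← h, ← h, ih]

theorem vtx_of_ne (ε : Bool) (i : Fin (k + 1)) {j : Fin (e + 2)} (h0 : j ≠ 0) (h1 : j ≠ 1) :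
    (doubledSimplex e k).vtx (ε, i) j = (doubledSimplex e k).vtx (ε, 0) j := by
  induction i using Fin.induction with
  | zero => rfl
  | succ i ih =>
    rw [← ih, Triangulation.vtx_eq_of_glue (glue_succ ε i.castSucc i.succ (by simp)) h0,
      swap_apply_of_ne_of_ne h0 h1]

theorem numVertices (he : 0 < e) : (doubledSimplex e k).numVertices = k + e + 2 := by
  have h01 : (0 : Fin (e + 2)) ≠ 1 := by simp
  -- The points of the subdivided edge get labels `0, …, k + 1`; the other corners have `j ≥ 2`, so
  -- their labels start at `k + 2`.
  let v : (doubledSimplex e k).Facet → Fin (e + 2) → ℕ := fun p j =>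
    if j = 0 then p.2 else if j = 1 then p.2 + 1 else k + j
  have v0 : ∀ p, v p 0 = p.2 := fun p => rfl
  have v1 : ∀ p, v p 1 = p.2 + 1 := fun p => rfl
  have v2 : ∀ p j, j ≠ 0 → j ≠ 1 → v p j = k + j := fun p j h0 h1 => by simp [v, h0, h1]
  have hge : ∀ j : Fin (e + 2), j ≠ 0 → j ≠ 1 → 2 ≤ (j : ℕ) := by
    intro j h0 h1
    have h0' : (j : ℕ) ≠ 0 := fun h => h0 (Fin.ext h)
    have h1' : (j : ℕ) ≠ 1 := fun h => h1 (Fin.ext h)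
    omega
  have hcase : ∀ j : Fin (e + 2), j = 0 ∨ j = 1 ∨ (j ≠ 0 ∧ j ≠ 1) := by
    intro j; tauto
  refine Triangulation.numVertices_eq_of_label v ?_ ?_ ?_ ?_
  · intro p i q π h j hj
    rcases glue_eq_some_iff.1 h with ⟨rfl, h1, h2, rfl⟩ | ⟨rfl, h1, h2, rfl⟩ | ⟨h1, h2, rfl, rfl⟩
    · rcases hcase j with rfl | rfl | ⟨h3, h4⟩
      · exact absurd rfl hj
      · rw [swap_apply_right, v0, v1, h2]
      · rw [swap_apply_of_ne_of_ne h3 h4, v2 _ _ h3 h4, v2 _ _ h3 h4]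
    · rcases hcase j with rfl | rfl | ⟨h3, h4⟩
      · rw [swap_apply_left, v0, v1, h2]
      · exact absurd rfl hj
      · rw [swap_apply_of_ne_of_ne h3 h4, v2 _ _ h3 h4, v2 _ _ h3 h4]
    · rfl
  · intro p j
    have hp := p.2.2
    have hj := j.2
    rcases hcase j with rfl | rfl | ⟨h3, h4⟩
    · rw [v0]; omega
    · rw [v1]; omega
    · rw [v2 _ _ h3 h4]; omega
  · intro m hm
    rcases Nat.lt_or_ge m (k + 1) with h | h
    · exact ⟨(true, ⟨m, h⟩), 0, rfl⟩
    · rcases Nat.eq_or_lt_of_le h with h | h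
      · exact ⟨(true, ⟨k, by omega⟩), 1, h⟩
      · refine ⟨(true, 0), ⟨m - k, by omega⟩, ?_⟩
        rw [v2]
        · simp only; omega
        · simp only [ne_eq, Fin.ext_iff, Fin.val_zero]; omega
        · simp only [ne_eq, Fin.ext_iff, Fin.val_one]; omega
  · rintro ⟨ε, i⟩ j ⟨δ, i'⟩ j' h
    rw [vtx_true he ε, vtx_true he δ]
    have hi := i.2
    have hi' := i'.2
    have hsucc : ∀ i i' : Fin (k + 1), (i' : ℕ) = i + 1 →
        (doubledSimplex e k).vtx (true, i) 1 = (doubledSimplex e k).vtx (true, i') 0 := by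
      intro i i' h
      rw [Triangulation.vtx_eq_of_glue (glue_succ true i i' h) h01.symm, swap_apply_right]
    rcases hcase j with rfl | rfl | ⟨h3, h4⟩ <;> rcases hcase j' with rfl | rfl | ⟨h3', h4'⟩
    · rw [v0, v0] at h
      obtain rfl : i = i' := Fin.ext h
      rfl
    · rw [v0, v1] at h
      exact (hsucc i' i h).symm
    · rw [v0, v2 _ _ h3' h4'] at h
      have := hge j' h3' h4'
      simp only at h; omega
    · rw [v1, v0] at h
      exact hsucc i i' h.symm
    · rw [v1, v1] at h
      obtain rfl : i = i' := Fin.ext (Nat.succ_injective h)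
      rfl
    · rw [v1, v2 _ _ h3' h4'] at h
      have := hge j' h3' h4'
      simp only at h; omega
    · rw [v0, v2 _ _ h3 h4] at h
      have := hge j h3 h4
      simp only at h; omega
    · rw [v1, v2 _ _ h3 h4] at h
      have := hge j h3 h4
      simp only at h; omega
    · rw [v2 _ _ h3 h4, v2 _ _ h3' h4'] at h
      rw [vtx_of_ne _ i h3 h4, vtx_of_ne _ i' h3' h4', Fin.ext (by omega : (j : ℕ) = j')]

end doubledSimplex

end DoubledSimplex

/-! ### The boundary of a simplex as a double. -/

section SimplexBoundary

variable {n : ℕ}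

/-- The smallest barycentric coordinate. -/
noncomputable def minCoord (z : stdSimplex ℝ (Fin (n + 1))) : ℝ :=
  Finset.univ.inf' Finset.univ_nonempty fun j => z.1 j

theorem minCoord_le (z : stdSimplex ℝ (Fin (n + 1))) (j : Fin (n + 1)) : minCoord z ≤ z.1 j :=
  Finset.inf'_le _ (Finset.mem_univ j)

theorem exists_eq_minCoord (z : stdSimplex ℝ (Fin (n + 1))) : ∃ j, minCoord z = z.1 j := by
  obtain ⟨j, -, h⟩ := Finset.exists_mem_eq_inf' Finset.univ_nonempty fun j => z.1 j
  exact ⟨j, h⟩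

theorem minCoord_nonneg (z : stdSimplex ℝ (Fin (n + 1))) : 0 ≤ minCoord z := by
  obtain ⟨j, h⟩ := exists_eq_minCoord z
  rw [h]
  exact z.2.1 j

theorem minCoord_eq_zero_iff {z : stdSimplex ℝ (Fin (n + 1))} :
    minCoord z = 0 ↔ ∃ j, z.1 j = 0 := by
  constructor
  · intro h
    obtain ⟨j, hj⟩ := exists_eq_minCoord z
    exact ⟨j, hj ▸ h⟩
  · rintro ⟨j, hj⟩
    exact le_antisymm (hj ▸ minCoord_le z j) (minCoord_nonneg z)

theorem continuous_minCoord : Continuous (minCoord (n := n)) :=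
  Continuous.finset_inf'_apply Finset.univ_nonempty fun j _ =>
    (continuous_apply j).comp continuous_subtype_val

theorem isCellwiseAffine_coord (j : Fin n) :
    IsCellwiseAffine fun z : stdSimplex ℝ (Fin n) => z.1 j :=
  isCellwiseAffine_affine (LinearMap.proj j : (Fin n → ℝ) →ₗ[ℝ] ℝ).toAffineMap

theorem isCellwiseAffine_minCoord : IsCellwiseAffine (minCoord (n := n)) := by
  have h := Finset.inf'_induction (s := (Finset.univ : Finset (Fin (n + 1))))
    Finset.univ_nonempty (fun j => fun z : stdSimplex ℝ (Fin (n + 1)) => z.1 j)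
    (p := IsCellwiseAffine) (fun f hf g hg => hf.min hg) (fun j _ => isCellwiseAffine_coord j)
  convert h using 1
  ext z
  rw [Finset.inf'_apply]
  rfl

/-- The boundary of the standard `(n + 1)`-simplex in `ℝ^(n + 1)` as the double of an `n`-simplex:
one copy is the facet opposite to the origin, the other one is the union of the other facets. -/
noncomputable def doubleMap (ε : Bool) (z : stdSimplex ℝ (Fin (n + 1))) :
    EuclideanSpace ℝ (Fin (n + 1)) :=
  WithLp.toLp 2 fun j => z.1 j - if ε then 0 else minCoord z

theorem doubleMap_apply (ε : Bool) (z : stdSimplex ℝ (Fin (n + 1))) (j : Fin (n + 1)) :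
    doubleMap ε z j = z.1 j - if ε then 0 else minCoord z := rfl

theorem continuous_doubleMap (ε : Bool) : Continuous (doubleMap (n := n) ε) := by
  refine (PiLp.continuous_toLp 2 _).comp (continuous_pi fun j => ?_)
  refine ((continuous_apply j).comp continuous_subtype_val).sub ?_
  cases ε
  · exact continuous_minCoord
  · exact continuous_const

theorem isCellwiseAffine_doubleMap (ε : Bool) : IsCellwiseAffine (doubleMap (n := n) ε) := by
  refine IsCellwiseAffine.toLp fun j => ?_
  cases ε
  · have h := (isCellwiseAffine_coord j).add (isCellwiseAffine_minCoord.const_smul (-1))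
    convert h using 2 with z
    simp [doubleMap_apply, sub_eq_add_neg]
  · convert isCellwiseAffine_coord j using 2 with z
    simp [doubleMap_apply]

theorem doubleMap_eq_of_minCoord_eq_zero {z : stdSimplex ℝ (Fin (n + 1))} (h : minCoord z = 0)
    (ε δ : Bool) : doubleMap ε z = doubleMap δ z := by
  ext j
  simp [doubleMap_apply, h]

theorem sum_doubleMap (ε : Bool) (z : stdSimplex ℝ (Fin (n + 1))) :
    ∑ j, doubleMap ε z j = 1 - (n + 1) * if ε then 0 else minCoord z := by
  simp only [doubleMap_apply, Finset.sum_sub_distrib, z.2.2]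
  simp

/-- The sum of the coordinates of the image reveals the amount subtracted, so `z` can be recovered;
the copies meet only where that amount is zero. -/
theorem doubleMap_eq_iff {ε δ : Bool} {z w : stdSimplex ℝ (Fin (n + 1))}
    (h : doubleMap ε z = doubleMap δ w) : z = w ∧ (ε = δ ∨ ∃ j, z.1 j = 0) := by
  have hn : (n : ℝ) + 1 ≠ 0 := by positivity
  have hs : (if ε then 0 else minCoord z) = (if δ then 0 else minCoord w) := by
    have h1 := sum_doubleMap ε z
    rw [h, sum_doubleMap δ w] at h1
    exact mul_left_cancel₀ hn (by linarith)
  have hzw : z = w := by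
    refine Subtype.ext (funext fun j => ?_)
    have h1 : doubleMap ε z j = doubleMap δ w j := by rw [h]
    rw [doubleMap_apply, doubleMap_apply, hs] at h1
    linarith
  refine ⟨hzw, ?_⟩
  subst hzw
  cases ε <;> cases δ
  · exact Or.inl rfl
  · exact Or.inr (minCoord_eq_zero_iff.1 (by simpa using hs))
  · exact Or.inr (minCoord_eq_zero_iff.1 (by simpa using hs.symm))
  · exact Or.inl rfl

/-- The defining inequalities of the standard simplex with a vertex at the origin. -/
noncomputable def cornerSimplexIneq (n : ℕ) :
    Option (Fin (n + 1)) → EuclideanSpace ℝ (Fin (n + 1)) →ᵃ[ℝ] ℝ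
  | some j => (EuclideanSpace.proj j : _ →L[ℝ] ℝ).toLinearMap.toAffineMap
  | none => AffineMap.const ℝ _ 1 -
      (∑ j, (EuclideanSpace.proj j : _ →L[ℝ] ℝ).toLinearMap).toAffineMap

theorem cornerSimplexIneq_some (j : Fin (n + 1)) (y : EuclideanSpace ℝ (Fin (n + 1))) :
    cornerSimplexIneq n (some j) y = y j := rfl

theorem cornerSimplexIneq_none (y : EuclideanSpace ℝ (Fin (n + 1))) :
    cornerSimplexIneq n none y = 1 - ∑ j, y j := by
  simp [cornerSimplexIneq]

theorem mem_polyhedron_cornerSimplexIneq {y : EuclideanSpace ℝ (Fin (n + 1))} :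
    y ∈ polyhedron (cornerSimplexIneq n) ↔ (∀ j, 0 ≤ y j) ∧ ∑ j, y j ≤ 1 := by
  constructor
  · intro h
    refine ⟨fun j => h (some j), ?_⟩
    have := h none
    rw [cornerSimplexIneq_none] at this
    linarith
  · rintro ⟨h, h'⟩ (_ | j)
    · rw [cornerSimplexIneq_none]; linarith
    · exact h j

theorem isBounded_cornerSimplex : Bornology.IsBounded (polyhedron (cornerSimplexIneq n)) := by
  refine EuclideanSpace.isBounded_of_abs_le_one fun y hy j => ?_
  obtain ⟨h0, h1⟩ := mem_polyhedron_cornerSimplexIneq.1 hy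
  rw [abs_of_nonneg (h0 j)]
  exact (Finset.single_le_sum (fun i _ => h0 i) (Finset.mem_univ j)).trans h1

theorem doubleMap_mem (ε : Bool) (z : stdSimplex ℝ (Fin (n + 1))) :
    doubleMap ε z ∈ polyhedron (cornerSimplexIneq n) ∧
      ∃ k, cornerSimplexIneq n k (doubleMap ε z) = 0 := by
  rw [mem_polyhedron_cornerSimplexIneq, sum_doubleMap]
  cases ε
  · refine ⟨⟨fun j => ?_, ?_⟩, ?_⟩
    · simpa [doubleMap_apply] using minCoord_le z j
    · have : 0 ≤ ((n : ℝ) + 1) * minCoord z := mul_nonneg (by positivity) (minCoord_nonneg z)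
      simpa using this
    · obtain ⟨j, hj⟩ := exists_eq_minCoord z
      exact ⟨some j, by simp [cornerSimplexIneq_some, doubleMap_apply, hj]⟩
  · refine ⟨⟨fun j => ?_, by simp⟩, none, ?_⟩
    · simpa [doubleMap_apply] using z.2.1 j
    · rw [cornerSimplexIneq_none, sum_doubleMap]
      simp

theorem exists_doubleMap_eq {y : EuclideanSpace ℝ (Fin (n + 1))}
    (hy : y ∈ polyhedron (cornerSimplexIneq n)) (h : ∃ k, cornerSimplexIneq n k y = 0) :
    ∃ ε z, doubleMap ε z = y := by
  obtain ⟨h0, h1⟩ := mem_polyhedron_cornerSimplexIneq.1 hy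
  by_cases hs : ∑ j, y j = 1
  · exact ⟨true, ⟨fun j => y j, h0, hs⟩, by ext j; simp [doubleMap_apply]⟩
  · have hex : ∃ j, y j = 0 := by
      obtain ⟨k | j, h⟩ := h
      · rw [cornerSimplexIneq_none] at h
        exact absurd (by linarith) hs
      · exact ⟨_, h⟩
    obtain ⟨j, hj⟩ := hex
    have hn : (0 : ℝ) < n + 1 := by positivity
    -- Raise all coordinates equally until they sum to 1. Since `y j = 0` for some `j`, the smallest
    -- coordinate becomes `c`.
    set c := (1 - ∑ j, y j) / (n + 1) with hc
    have hc0 : 0 ≤ c := div_nonneg (by linarith) hn.le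
    let z : stdSimplex ℝ (Fin (n + 1)) := ⟨fun j => y j + c, fun j => add_nonneg (h0 j) hc0, by
      rw [Finset.sum_add_distrib]
      simp [hc]
      field_simp
      ring⟩
    have hmin : minCoord z = c := by
      refine le_antisymm ((minCoord_le z j).trans (by simp [z, hj])) ?_
      obtain ⟨l, hl⟩ := exists_eq_minCoord z
      rw [hl]
      simpa [z] using h0 l
    refine ⟨false, z, ?_⟩
    ext l
    simp [doubleMap_apply, hmin, z]

end SimplexBoundary

/-! ### The doubled simplex is a sphere. -/

namespace doubledSimplex

variable {e k : ℕ}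

theorem isOfSphere : (doubledSimplex e k).IsOfSphere := by
  have h01 : (0 : Fin (e + 2)) ≠ 1 := by simp
  refine isClosed.isOfSphere (cornerSimplexIneq (e + 1)) isBounded_cornerSimplex
    -- The barycentre of the `(e + 2)`-simplex.
    (y₀ := WithLp.toLp 2 fun _ => 1 / (e + 3)) ?_
    (fun p x => doubleMap p.1 (edgeSubdivSimplex p.2 x))
    (fun p => (isCellwiseAffine_doubleMap p.1).comp_edgeSubdivSimplex p.2)
    (fun p => (continuous_doubleMap p.1).comp (continuous_edgeSubdivSimplex p.2))
    ?_ (fun p x => doubleMap_mem _ _) ?_ ?_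
  · rintro (_ | j)
    · rw [cornerSimplexIneq_none]
      have : (0 : ℝ) < 1 / (e + 3) := by positivity
      simp only [Finset.sum_const, Finset.card_univ, Fintype.card_fin, nsmul_eq_mul]
      push_cast
      have h2 : ((e : ℝ) + 1 + 1) * (1 / (e + 3)) = 1 - 1 / (e + 3) := by field_simp; ring
      rw [h2]
      linarith
    · rw [cornerSimplexIneq_some]
      simp only
      positivity
  · rintro ⟨ε, i⟩ j ⟨δ, i'⟩ π h x y hx hy
    rcases glue_eq_some_iff.1 h with ⟨rfl, h1, h2, rfl⟩ | ⟨rfl, h1, h2, rfl⟩ | ⟨h1, h2, h3, rfl⟩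
    · simp only at h1 h2
      subst h1
      have : y = stdSimplex.permute (swap 0 1) x :=
        Subtype.ext (funext fun l => by
          have h3 := hy (swap 0 1 l)
          rwa [swap_apply_self] at h3)
      simp only
      rw [this, edgeSubdivSimplex_permute_swap h2 hx]
    · simp only at h1 h2
      subst h1
      have : x = stdSimplex.permute (swap 0 1) y := Subtype.ext (funext fun l => (hy l).symm)
      have hy0 : y.1 0 = 0 := by simpa [hx] using hy 1
      simp only
      rw [this, edgeSubdivSimplex_permute_swap h2 hy0]
    · obtain rfl : x = y := Subtype.ext (funext fun l => (hy l).symm)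
      simp only [Prod.mk.injEq] at h3
      obtain ⟨rfl, rfl⟩ := h3
      refine doubleMap_eq_of_minCoord_eq_zero (minCoord_eq_zero_iff.2 ⟨j, ?_⟩) _ _
      simp only at h1 h2 ⊢
      by_cases hj0 : j = 0
      · subst hj0
        have hi : i' = Fin.last k := Fin.ext (by simp only [Fin.val_last]; have := i'.2; omega)
        rw [hi, edgeSubdivSimplex_last hx, hx]
      · by_cases hj1 : j = 1
        · subst hj1
          have hi : i' = 0 := Fin.ext (by simp only [Fin.val_zero]; omega)
          rw [hi, edgeSubdivSimplex_first hx, hx]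
        · exact (edgeSubdiv_of_ne _ _ _ hj0 hj1).trans hx
  · intro y hy h
    obtain ⟨ε, z, rfl⟩ := exists_doubleMap_eq hy h
    obtain ⟨i, x, rfl⟩ := exists_edgeSubdivSimplex_eq k.succ_pos z
    exact ⟨(ε, i), x, rfl⟩
  · rintro ⟨ε, i⟩ x ⟨δ, i'⟩ y h
    have hsame : ∀ (ε : Bool) (i i' : Fin (k + 1)) (x y : stdSimplex ℝ (Fin (e + 2))),
        edgeSubdivSimplex i x = edgeSubdivSimplex i' y →
        (doubledSimplex e k).facetMap (ε, i) x = (doubledSimplex e k).facetMap (ε, i') y :=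
      fun ε i i' x y h => Triangulation.facetMap_eq_of_edgeSubdivSimplex_eq
        (T := doubledSimplex e k) (fun i => (ε, i)) (glue_succ ε) h
    -- In different copies the common point has a zero coordinate `j`. If `j` is 0 or 1, it is first
    -- moved to the last or first piece, whose ridge there is glued across.
    obtain ⟨hxy, rfl | ⟨j, hj⟩⟩ := doubleMap_eq_iff h
    · exact hsame ε i i' x y hxy
    · simp only at hxy hj
      have hflip : ∀ (i : Fin (k + 1)) (x : stdSimplex ℝ (Fin (e + 2))) (j : Fin (e + 2)),
          x.1 j = 0 → ¬ (j = 0 ∧ (i : ℕ) < k) → ¬ (j = 1 ∧ 0 < (i : ℕ)) →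
          (doubledSimplex e k).facetMap (ε, i) x = (doubledSimplex e k).facetMap (δ, i) x := by
        intro i x j hx h0 h1
        by_cases hεδ : δ = ε
        · rw [hεδ]
        · obtain rfl : δ = !ε := by cases ε <;> cases δ <;> simp_all
          exact Triangulation.facetMap_eq_of_glue (glue_other ε i h0 h1) hx (fun _ => rfl)
      by_cases hj0 : j = 0
      · subst hj0
        have hz := edgeSubdivSimplex_last (k := k) hj
        rw [hsame ε i _ x _ hz.symm, hflip _ _ 0 hj (by simp) (fun h => h01 h.1)]
        exact hsame δ _ _ _ _ (hz.trans hxy)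
      · by_cases hj1 : j = 1
        · subst hj1
          have hz := edgeSubdivSimplex_first (k := k) hj
          rw [hsame ε i _ x _ hz.symm, hflip _ _ 1 hj (fun h => h01 h.1.symm) (by simp)]
          exact hsame δ _ _ _ _ (hz.trans hxy)
        · have hx : x.1 j = 0 := (edgeSubdiv_of_ne _ _ _ hj0 hj1).symm.trans hj
          rw [hflip i x j hx (fun h => hj0 h.1) (fun h => hj1 h.1)]
          exact hsame δ _ _ _ _ hxy

end doubledSimplex

/-! ### Pairing the corners of an odd-dimensional simplex. -/

section Partner

variable {m : ℕ}

/-- The involution `2i ↔ 2i + 1`. -/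
def partner (j : Fin (2 * m + 2)) : Fin (2 * m + 2) :=
  if h : Even (j : ℕ) then ⟨j + 1, by obtain ⟨r, hr⟩ := h; omega⟩ else ⟨j - 1, by omega⟩

theorem partner_val_of_even {j : Fin (2 * m + 2)} (h : Even (j : ℕ)) :
    (partner j : ℕ) = j + 1 := by
  simp [partner, h]

theorem partner_val_of_not_even {j : Fin (2 * m + 2)} (h : ¬ Even (j : ℕ)) :
    (partner j : ℕ) = j - 1 := by
  simp [partner, h]

theorem even_partner_iff {j : Fin (2 * m + 2)} : Even (partner j : ℕ) ↔ ¬ Even (j : ℕ) := by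
  by_cases h : Even (j : ℕ)
  · rw [partner_val_of_even h, Nat.even_add_one]
  · rw [partner_val_of_not_even h]
    obtain ⟨r, hr⟩ := Nat.not_even_iff_odd.1 h
    simp [hr]

theorem partner_involutive : Function.Involutive (partner (m := m)) := by
  intro j
  apply Fin.ext
  by_cases h : Even (j : ℕ)
  · rw [partner_val_of_not_even (by rwa [even_partner_iff, not_not]), partner_val_of_even h]
    omega
  · rw [partner_val_of_even (even_partner_iff.2 h), partner_val_of_not_even h]
    obtain ⟨r, hr⟩ := Nat.not_even_iff_odd.1 h
    omega

theorem partner_partner (j : Fin (2 * m + 2)) : partner (partner j) = j := partner_involutive j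

theorem partner_ne (j : Fin (2 * m + 2)) : partner j ≠ j := by
  intro h
  have := even_partner_iff (j := j)
  rw [h] at this
  tauto

theorem partner_zero : partner (0 : Fin (2 * m + 2)) = 1 :=
  Fin.ext (by rw [partner_val_of_even (by simp)]; simp)

theorem partner_one : partner (1 : Fin (2 * m + 2)) = 0 := by
  rw [← partner_zero, partner_partner]

theorem partner_eq_iff {j l : Fin (2 * m + 2)} : partner j = l ↔ j = partner l :=
  ⟨fun h => h ▸ (partner_partner j).symm, fun h => h ▸ partner_partner l⟩

theorem partner_ne_zero {j : Fin (2 * m + 2)} (h : j ≠ 1) : partner j ≠ 0 := by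
  rwa [ne_eq, partner_eq_iff, partner_zero]

theorem partner_ne_one {j : Fin (2 * m + 2)} (h : j ≠ 0) : partner j ≠ 1 := by
  rwa [ne_eq, partner_eq_iff, partner_one]

theorem partner_div_two (j : Fin (2 * m + 2)) : (partner j : ℕ) / 2 = j / 2 := by
  by_cases h : Even (j : ℕ)
  · rw [partner_val_of_even h]
    obtain ⟨r, hr⟩ := h
    omega
  · rw [partner_val_of_not_even h]
    obtain ⟨r, hr⟩ := Nat.not_even_iff_odd.1 h
    omega

theorem eq_or_eq_partner_of_div_two {j l : Fin (2 * m + 2)} (h : (j : ℕ) / 2 = l / 2) :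
    j = l ∨ j = partner l := by
  by_cases hl : Even (l : ℕ)
  · have h1 := partner_val_of_even hl
    obtain ⟨r, hr⟩ := hl
    simp only [Fin.ext_iff, h1]
    omega
  · have h1 := partner_val_of_not_even hl
    obtain ⟨r, hr⟩ := Nat.not_even_iff_odd.1 hl
    simp only [Fin.ext_iff, h1]
    omega

end Partner

/-! ### The join of a cycle with one-edge circles: combinatorics. -/

section JoinedCircles

/-- The facet across a ridge in the join of an `(n + 1)`-cycle with one-edge circles. -/
def cycleStep {m n : ℕ} (j : Fin (2 * m + 2)) (i : Fin (n + 1)) : Fin (n + 1) :=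
  if j = 0 then i + 1 else if j = 1 then i - 1 else i

theorem cycleStep_partner {m n : ℕ} (j : Fin (2 * m + 2)) (i : Fin (n + 1)) :
    cycleStep (partner j) (cycleStep j i) = i := by
  by_cases h0 : j = 0
  · subst h0
    simp [partner_zero, cycleStep]
  · by_cases h1 : j = 1
    · subst h1
      simp [partner_one, cycleStep]
    · simp [cycleStep, h0, h1, partner_ne_zero h1, partner_ne_one h0]

/-- The join of an `(n + 1)`-cycle with `m` circles consisting of one edge each. -/
abbrev joinedCircles (m n : ℕ) : Triangulation (2 * m + 1) where
  Facet := Fin (n + 1)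
  finite_facet := inferInstance
  -- The corners 0 and 1 span the edge number `i` of the cycle, so their ridges lead to the
  -- neighbouring facets. Any other pair spans an edge closed up to a loop: its two ridges are glued
  -- to each other within the facet.
  glue i j := some (cycleStep j i, swap j (partner j))
  glue_symm := by
    intro i j i' π h
    simp only [Option.some.injEq, Prod.mk.injEq] at h
    obtain ⟨rfl, rfl⟩ := h
    rw [swap_apply_left, cycleStep_partner, partner_partner, symm_swap, swap_comm]
  glue_ne_self := by
    intro i j i' π h h'
    simp only [Option.some.injEq, Prod.mk.injEq] at h h'
    rw [← h.2, swap_apply_left] at h'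
    exact partner_ne j h'.2

namespace joinedCircles

variable {m n : ℕ}

theorem isClosed : (joinedCircles m n).IsClosed := fun _ _ => Option.some_ne_none _

theorem numFacets : (joinedCircles m n).numFacets = n + 1 := by
  change Nat.card (Fin (n + 1)) = _
  simp

theorem glue_zero (i : Fin (n + 1)) :
    (joinedCircles m n).glue i 0 = some (i + 1, swap 0 1) := by
  simp [cycleStep, partner_zero]

theorem glue_one (i : Fin (n + 1)) :
    (joinedCircles m n).glue i 1 = some (i - 1, swap 0 1) := by
  simp [cycleStep, partner_one, swap_comm]

theorem glue_of_ne (i : Fin (n + 1)) {j : Fin (2 * m + 2)} (h0 : j ≠ 0) (h1 : j ≠ 1) :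
    (joinedCircles m n).glue i j = some (i, swap j (partner j)) := by
  simp [cycleStep, h0, h1]

theorem vtx_of_ne (i : Fin (n + 1)) {j : Fin (2 * m + 2)} (h0 : j ≠ 0) (h1 : j ≠ 1) :
    (joinedCircles m n).vtx i j = (joinedCircles m n).vtx 0 j := by
  induction i using Fin.induction with
  | zero => rfl
  | succ i ih =>
    rw [← ih, Triangulation.vtx_eq_of_glue (glue_zero i.castSucc) h0,
      swap_apply_of_ne_of_ne h0 h1, Fin.coeSucc_eq_succ]

theorem numVertices : (joinedCircles m n).numVertices = n + 1 + m := by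
  have h01 : (0 : Fin (2 * m + 2)) ≠ 1 := by simp
  -- The cycle uses the labels `0, …, n`, with addition in `Fin (n + 1)` wrapping around. Every
  -- further pair of corners is one vertex, and `j / 2 ≥ 1` puts its label above `n`.
  let v : (joinedCircles m n).Facet → Fin (2 * m + 2) → ℕ := fun i j =>
    if j = 0 then i.val else if j = 1 then (i + 1).val else n + j / 2
  have v0 : ∀ i, v i 0 = i.val := fun i => rfl
  have v1 : ∀ i, v i 1 = (i + 1).val := fun i => rfl
  have v2 : ∀ i j, j ≠ 0 → j ≠ 1 → v i j = n + j / 2 := fun i j h0 h1 => by simp [v, h0, h1]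
  have hge : ∀ j : Fin (2 * m + 2), j ≠ 0 → j ≠ 1 → 1 ≤ (j : ℕ) / 2 := by
    intro j h0 h1
    have h0' : (j : ℕ) ≠ 0 := fun h => h0 (Fin.ext h)
    have h1' : (j : ℕ) ≠ 1 := fun h => h1 (Fin.ext h)
    omega
  have hcase : ∀ j : Fin (2 * m + 2), j = 0 ∨ j = 1 ∨ (j ≠ 0 ∧ j ≠ 1) := by
    intro j; tauto
  refine Triangulation.numVertices_eq_of_label v ?_ ?_ ?_ ?_
  · intro i l i' π h j hj
    simp only [Option.some.injEq, Prod.mk.injEq] at h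
    obtain ⟨rfl, rfl⟩ := h
    rcases hcase l with rfl | rfl | ⟨h3, h4⟩
    · rw [partner_zero]
      have hs : cycleStep (0 : Fin (2 * m + 2)) i = i + 1 := rfl
      rw [hs]
      rcases hcase j with rfl | rfl | ⟨h5, h6⟩
      · exact absurd rfl hj
      · rw [swap_apply_right, v0, v1]
      · rw [swap_apply_of_ne_of_ne h5 h6, v2 _ _ h5 h6, v2 _ _ h5 h6]
    · rw [partner_one]
      have hs : cycleStep (1 : Fin (2 * m + 2)) i = i - 1 := rfl
      rw [hs]
      rcases hcase j with rfl | rfl | ⟨h5, h6⟩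
      · rw [swap_apply_right, v0, v1, sub_add_cancel]
      · exact absurd rfl hj
      · rw [swap_apply_of_ne_of_ne h6 h5, v2 _ _ h5 h6, v2 _ _ h5 h6]
    · have hs : cycleStep l i = i := by simp [cycleStep, h3, h4]
      rw [hs]
      by_cases hjl : j = partner l
      · subst hjl
        rw [swap_apply_right, v2 _ _ h3 h4, v2 _ _ (partner_ne_zero h4) (partner_ne_one h3),
          partner_div_two]
      · rw [swap_apply_of_ne_of_ne hj hjl]
  · intro i j
    have hi := i.2
    have hi' := (i + 1).2
    have hj := j.2
    rcases hcase j with rfl | rfl | ⟨h3, h4⟩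
    · rw [v0]; omega
    · rw [v1]; omega
    · rw [v2 _ _ h3 h4]; omega
  · intro a ha
    rcases Nat.lt_or_ge a (n + 1) with h | h
    · exact ⟨⟨a, h⟩, 0, rfl⟩
    · refine ⟨0, ⟨2 * (a - n), by omega⟩, ?_⟩
      rw [v2]
      · simp only; omega
      · simp only [ne_eq, Fin.ext_iff, Fin.val_zero]; omega
      · simp only [ne_eq, Fin.ext_iff, Fin.val_one]; omega
  · have hone : ∀ i : Fin (n + 1),
        (joinedCircles m n).vtx i 1 = (joinedCircles m n).vtx (i + 1) 0 := by
      intro i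
      rw [Triangulation.vtx_eq_of_glue (glue_zero i) h01.symm, swap_apply_right]
    have hlt : ∀ i : Fin (n + 1), ∀ j : Fin (2 * m + 2), j ≠ 0 → j ≠ 1 → i.val ≠ n + j / 2 := by
      intro i j h0 h1
      have := hge j h0 h1
      have := i.2
      omega
    intro i j i' j' h
    rcases hcase j with rfl | rfl | ⟨h3, h4⟩ <;> rcases hcase j' with rfl | rfl | ⟨h3', h4'⟩
    · obtain rfl : i = i' := Fin.ext h
      rfl
    · rw [hone, show i = i' + 1 from Fin.ext h]
    · rw [v0, v2 _ _ h3' h4'] at h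
      exact absurd h (hlt _ _ h3' h4')
    · rw [hone, show i + 1 = i' from Fin.ext h]
    · rw [hone, hone, show i + 1 = i' + 1 from Fin.ext h]
    · rw [v1, v2 _ _ h3' h4'] at h
      exact absurd h (hlt _ _ h3' h4')
    · rw [v0, v2 _ _ h3 h4] at h
      exact absurd h.symm (hlt _ _ h3 h4)
    · rw [v1, v2 _ _ h3 h4] at h
      exact absurd h.symm (hlt _ _ h3 h4)
    · rw [v2 _ _ h3 h4, v2 _ _ h3' h4'] at h
      rw [vtx_of_ne i h3 h4, vtx_of_ne i' h3' h4']
      rcases eq_or_eq_partner_of_div_two (Nat.add_left_cancel h) with rfl | rfl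
      · rfl
      · rw [Triangulation.vtx_eq_of_glue (glue_of_ne 0 h3' h4') (partner_ne j'),
          swap_apply_right]

end joinedCircles

end JoinedCircles

/-! ### Wrapping a quadrant around the plane. -/

section Fold

/-- The first coordinate of the parametrization of the plane by the quadrant, which wraps
the segments of constant coordinate sum around diamonds. -/
noncomputable def wrapFst (a b : ℝ) : ℝ := a + b - 2 * max (a - b) (b - a)

/-- The second coordinate of the parametrization of the plane by the quadrant, which wraps
the segments of constant coordinate sum around diamonds. -/
noncomputable def wrapSnd (a b : ℝ) : ℝ := 2 * max (-2 * a) (min (a - b) (2 * b))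

theorem wrap_of_le {a b : ℝ} (ha : 0 ≤ a) (hb : 0 ≤ b) (h : b ≤ a) :
    wrapFst a b = 3 * b - a ∧ wrapSnd a b = 2 * min (a - b) (2 * b) ∧ 0 ≤ wrapSnd a b := by
  have h1 : 0 ≤ min (a - b) (2 * b) := le_min (by linarith) (by linarith)
  have h2 : wrapSnd a b = 2 * min (a - b) (2 * b) := by
    rw [wrapSnd, max_eq_right (by linarith)]
  refine ⟨?_, h2, by rw [h2]; linarith⟩
  rw [wrapFst, max_eq_left (by linarith)]
  ring

theorem wrap_of_ge {a b : ℝ} (hb : 0 ≤ b) (h : a ≤ b) :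
    wrapFst a b = 3 * a - b ∧ wrapSnd a b = -(2 * min (b - a) (2 * a)) := by
  constructor
  · rw [wrapFst, max_eq_right (by linarith)]
    ring
  · rw [wrapSnd, min_eq_left (by linarith : a - b ≤ 2 * b), ← neg_sub b a,
      show -2 * a = -(2 * a) by ring, max_neg_neg, min_comm]
    ring

theorem wrapFst_comm (a b : ℝ) : wrapFst a b = wrapFst b a := by
  rw [wrapFst, wrapFst, max_comm, add_comm a b]

theorem wrapSnd_comm {a b : ℝ} (ha : 0 ≤ a) (hb : 0 ≤ b) : wrapSnd a b = -wrapSnd b a := by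
  rcases le_total a b with h | h
  · rw [(wrap_of_ge hb h).2, (wrap_of_le hb ha h).2.1]
  · rw [(wrap_of_ge ha h).2, (wrap_of_le ha hb h).2.1, neg_neg]

theorem abs_wrap_add_abs_wrap {a b : ℝ} (ha : 0 ≤ a) (hb : 0 ≤ b) :
    |wrapFst a b| + |wrapSnd a b| = a + b := by
  wlog h : b ≤ a generalizing a b
  · rw [wrapFst_comm, wrapSnd_comm ha hb, abs_neg, this hb ha (le_of_not_ge h), add_comm]
  obtain ⟨h1, h2, h3⟩ := wrap_of_le ha hb h
  rw [abs_of_nonneg h3, h1, h2]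
  rcases le_total (a - b) (2 * b) with h4 | h4
  · rw [min_eq_left h4, abs_of_nonneg (by linarith)]
    ring
  · rw [min_eq_right h4, abs_of_nonpos (by linarith)]
    ring

/-- The image determines `a + b`. The segment with that sum runs once around its diamond, the halves
`b ≤ a` and `a ≤ b` covering the upper and lower parts, so only its two endpoints are identified. -/
theorem wrap_injective {a b c d : ℝ} (ha : 0 ≤ a) (hb : 0 ≤ b) (hc : 0 ≤ c) (hd : 0 ≤ d)
    (h1 : wrapFst a b = wrapFst c d) (h2 : wrapSnd a b = wrapSnd c d) :
    (a = c ∧ b = d) ∨ (a = d ∧ b = c ∧ (a = 0 ∨ b = 0)) := by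
  have hs : a + b = c + d := by
    rw [← abs_wrap_add_abs_wrap ha hb, h1, h2, abs_wrap_add_abs_wrap hc hd]
  wlog h : b ≤ a generalizing a b c d
  · have := this hb ha hd hc (by rwa [wrapFst_comm b, wrapFst_comm d])
      (by rw [wrapSnd_comm hb ha, wrapSnd_comm hd hc, h2]) (by linarith) (le_of_not_ge h)
    tauto
  obtain ⟨h3, h4, h5⟩ := wrap_of_le ha hb h
  rcases le_total d c with h' | h'
  · left
    have h6 := (wrap_of_le hc hd h').1
    rw [h3, h6] at h1
    constructor <;> linarith
  · obtain ⟨h6, h7⟩ := wrap_of_ge hd h'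
    rw [h3, h6] at h1
    obtain rfl : a = d := by linarith
    obtain rfl : b = c := by linarith
    by_cases hab : a = b
    · exact Or.inl ⟨hab, hab.symm⟩
    · refine Or.inr ⟨rfl, rfl, Or.inr ?_⟩
      rw [h4, h7] at h2
      have h8 : min (a - b) (2 * b) = 0 := by linarith
      rcases min_choice (a - b) (2 * b) with h9 | h9
      · exact absurd (by linarith) hab
      · linarith

theorem exists_wrap_eq (x y : ℝ) : ∃ a b, 0 ≤ a ∧ 0 ≤ b ∧ wrapFst a b = x ∧ wrapSnd a b = y := by
  wlog h : 0 ≤ y generalizing y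
  · obtain ⟨a, b, ha, hb, h1, h2⟩ := this (-y) (by linarith)
    refine ⟨b, a, hb, ha, by rw [wrapFst_comm, h1], ?_⟩
    rw [wrapSnd_comm hb ha, h2, neg_neg]
  have hx := le_abs_self x
  have hx' := neg_abs_le x
  -- The solution of `a + b = |x| + y` and `3 * b - a = x`, the formulas valid for `b ≤ a`.
  refine ⟨(3 * (|x| + y) - x) / 4, (|x| + y + x) / 4, by linarith, by linarith, ?_⟩
  obtain ⟨h1, h2, -⟩ := wrap_of_le (a := (3 * (|x| + y) - x) / 4) (b := (|x| + y + x) / 4)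
    (by linarith) (by linarith) (by linarith)
  refine ⟨by rw [h1]; ring, ?_⟩
  rw [h2]
  rcases abs_cases x with ⟨h3, h4⟩ | ⟨h3, h4⟩
  · rw [min_eq_left (by linarith), h3]
    ring
  · rw [min_eq_right (by linarith), h3]
    ring

end Fold

/-! ### The boundary of the cross-polytope as a join of diamonds. -/

section CrossPolytope

variable {m : ℕ}

/-- The coordinates of the parametrization of the boundary of the cross-polytope by a simplex,
wrapping each edge `{j, partner j}` around a diamond. -/
noncomputable def wrapCoord (z : Fin (2 * m + 2) → ℝ) (j : Fin (2 * m + 2)) : ℝ :=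
  if Even (j : ℕ) then wrapFst (z j) (z (partner j)) else wrapSnd (z (partner j)) (z j)

/-- The parametrization of the boundary of the cross-polytope by a simplex. -/
noncomputable def wrapMap (z : stdSimplex ℝ (Fin (2 * m + 2))) :
    EuclideanSpace ℝ (Fin (2 * m + 2)) :=
  WithLp.toLp 2 (wrapCoord z.1)

theorem wrapCoord_of_even (z : Fin (2 * m + 2) → ℝ) {j : Fin (2 * m + 2)} (h : Even (j : ℕ)) :
    wrapCoord z j = wrapFst (z j) (z (partner j)) ∧
      wrapCoord z (partner j) = wrapSnd (z j) (z (partner j)) := by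
  have h' : ¬ Even (partner j : ℕ) := by rwa [even_partner_iff, not_not]
  rw [wrapCoord, if_pos h, wrapCoord, if_neg h', partner_partner]
  exact ⟨rfl, rfl⟩

theorem abs_wrapCoord_add {z : Fin (2 * m + 2) → ℝ} (hz : ∀ j, 0 ≤ z j) (j : Fin (2 * m + 2)) :
    |wrapCoord z j| + |wrapCoord z (partner j)| = z j + z (partner j) := by
  by_cases h : Even (j : ℕ)
  · obtain ⟨h1, h2⟩ := wrapCoord_of_even z h
    rw [h1, h2, abs_wrap_add_abs_wrap (hz _) (hz _)]
  · obtain ⟨h1, h2⟩ := wrapCoord_of_even z (even_partner_iff.2 h)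
    rw [partner_partner] at h1 h2
    rw [h1, h2, add_comm, abs_wrap_add_abs_wrap (hz _) (hz _), add_comm]

theorem sum_abs_wrapCoord {z : Fin (2 * m + 2) → ℝ} (hz : ∀ j, 0 ≤ z j) :
    ∑ j, |wrapCoord z j| = ∑ j, z j := by
  have h1 : ∑ j, (|wrapCoord z j| + |wrapCoord z (partner j)|) = ∑ j, (z j + z (partner j)) :=
    Finset.sum_congr rfl fun j _ => abs_wrapCoord_add hz j
  have hp : ∀ f : Fin (2 * m + 2) → ℝ, ∑ j, f (partner j) = ∑ j, f j :=
    fun f => Equiv.sum_comp partner_involutive.toPerm f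
  rw [Finset.sum_add_distrib, Finset.sum_add_distrib, hp fun j => |wrapCoord z j|, hp z] at h1
  linarith

theorem wrapCoord_eq_pair {z w : Fin (2 * m + 2) → ℝ} (hz : ∀ j, 0 ≤ z j) (hw : ∀ j, 0 ≤ w j)
    (h : ∀ j, wrapCoord z j = wrapCoord w j) (j : Fin (2 * m + 2)) :
    (z j = w j ∧ z (partner j) = w (partner j)) ∨
      (z j = w (partner j) ∧ z (partner j) = w j ∧ (z j = 0 ∨ z (partner j) = 0)) := by
  by_cases hj : Even (j : ℕ)
  · obtain ⟨h1, h2⟩ := wrapCoord_of_even z hj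
    obtain ⟨h3, h4⟩ := wrapCoord_of_even w hj
    exact wrap_injective (hz _) (hz _) (hw _) (hw _) (by rw [← h1, ← h3, h])
      (by rw [← h2, ← h4, h])
  · obtain ⟨h1, h2⟩ := wrapCoord_of_even z (even_partner_iff.2 hj)
    obtain ⟨h3, h4⟩ := wrapCoord_of_even w (even_partner_iff.2 hj)
    rw [partner_partner] at h1 h2 h3 h4
    have := wrap_injective (hz (partner j)) (hz j) (hw (partner j)) (hw j) (by rw [← h1, ← h3, h])
      (by rw [← h2, ← h4, h])
    tauto

theorem exists_wrapCoord_eq (y : Fin (2 * m + 2) → ℝ) :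
    ∃ z : Fin (2 * m + 2) → ℝ, (∀ j, 0 ≤ z j) ∧ wrapCoord z = y := by
  choose A B hA hB h1 h2 using exists_wrap_eq
  let z : Fin (2 * m + 2) → ℝ := fun j =>
    if Even (j : ℕ) then A (y j) (y (partner j)) else B (y (partner j)) (y j)
  have hz : ∀ j : Fin (2 * m + 2), Even (j : ℕ) →
      z j = A (y j) (y (partner j)) ∧ z (partner j) = B (y j) (y (partner j)) := by
    intro j h
    have h' : ¬ Even (partner j : ℕ) := by rwa [even_partner_iff, not_not]
    exact ⟨by simp only [z, if_pos h], by simp only [z, if_neg h', partner_partner]⟩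
  have hzy : ∀ j : Fin (2 * m + 2), Even (j : ℕ) →
      wrapCoord z j = y j ∧ wrapCoord z (partner j) = y (partner j) := by
    intro j h
    obtain ⟨h3, h4⟩ := wrapCoord_of_even z h
    rw [h3, h4, (hz j h).1, (hz j h).2]
    exact ⟨h1 _ _, h2 _ _⟩
  refine ⟨z, fun j => ?_, funext fun j => ?_⟩
  · by_cases h : Even (j : ℕ)
    · rw [(hz j h).1]
      exact hA _ _
    · have := (hz _ (even_partner_iff.2 h)).2
      rw [partner_partner] at this
      rw [this]
      exact hB _ _
  · by_cases h : Even (j : ℕ)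
    · exact (hzy j h).1
    · have := (hzy _ (even_partner_iff.2 h)).2
      rwa [partner_partner] at this

/-- With `z l = 0` the pair `{l, partner l}` is at an end of its segment, and wrapping sends both
ends to the same point. -/
theorem wrapMap_permute {z : stdSimplex ℝ (Fin (2 * m + 2))} {l : Fin (2 * m + 2)}
    (hl : z.1 l = 0) : wrapMap (stdSimplex.permute (swap l (partner l)) z) = wrapMap z := by
  have hX : ∀ a b, wrapFst a b = wrapFst b a := wrapFst_comm
  have hY : ∀ b, 0 ≤ b → wrapSnd 0 b = 0 := by
    intro b hb
    rw [(wrap_of_ge hb hb).2]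
    simp [hb]
  have hY' : ∀ b, 0 ≤ b → wrapSnd b 0 = 0 := by
    intro b hb
    rw [wrapSnd_comm hb le_rfl, hY b hb, neg_zero]
  ext j
  change wrapCoord (fun j => z.1 (swap l (partner l) j)) j = wrapCoord z.1 j
  by_cases h1 : j = l
  · subst h1
    simp only [wrapCoord, swap_apply_left, swap_apply_right, hl]
    split_ifs
    · exact hX _ _
    · rw [hY _ (z.2.1 _), hY' _ (z.2.1 _)]
  · by_cases h2 : j = partner l
    · subst h2
      simp only [wrapCoord, partner_partner, swap_apply_left, swap_apply_right, hl]
      split_ifs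
      · exact hX _ _
      · rw [hY _ (z.2.1 _), hY' _ (z.2.1 _)]
    · have h3 : partner j ≠ l := by rwa [ne_eq, partner_eq_iff]
      have h4 : partner j ≠ partner l := fun h => h1 (partner_involutive.injective h)
      simp only [wrapCoord, swap_apply_of_ne_of_ne h1 h2, swap_apply_of_ne_of_ne h3 h4]

theorem continuous_wrapMap : Continuous (wrapMap (m := m)) := by
  have hc : ∀ j, Continuous fun z : stdSimplex ℝ (Fin (2 * m + 2)) => z.1 j :=
    fun j => (continuous_apply j).comp continuous_subtype_val
  refine (PiLp.continuous_toLp 2 _).comp (continuous_pi fun j => ?_)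
  have h1 := hc j
  have h2 := hc (partner j)
  by_cases h : Even (j : ℕ)
  · simp only [wrapCoord, if_pos h, wrapFst]
    exact (h1.add h2).sub (continuous_const.mul ((h1.sub h2).max (h2.sub h1)))
  · simp only [wrapCoord, if_neg h, wrapSnd]
    exact continuous_const.mul ((continuous_const.mul h2).max
      ((h2.sub h1).min (continuous_const.mul h1)))

theorem isCellwiseAffine_wrapMap : IsCellwiseAffine (wrapMap (m := m)) := by
  refine IsCellwiseAffine.toLp fun j => ?_
  have h1 := isCellwiseAffine_coord j
  have h2 := isCellwiseAffine_coord (partner j)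
  by_cases h : Even (j : ℕ)
  · have h3 := (h1.add h2).add (((h1.add (h2.const_smul (-1))).max
      (h2.add (h1.const_smul (-1)))).const_smul (-2))
    convert h3 using 2 with z
    change wrapCoord z.1 j = _
    simp only [wrapCoord, if_pos h, wrapFst, smul_eq_mul, neg_mul, one_mul, sub_eq_add_neg]
  · have h3 := ((h2.const_smul (-2)).max ((h2.add (h1.const_smul (-1))).min
      (h1.const_smul 2))).const_smul 2
    convert h3 using 2 with z
    change wrapCoord z.1 j = _
    simp only [wrapCoord, if_neg h, wrapSnd, smul_eq_mul, neg_mul, one_mul, sub_eq_add_neg]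

/-- The defining inequalities of the cross-polytope. -/
noncomputable def crossPolytopeIneq (n : ℕ) (s : Fin n → ℤˣ) :
    EuclideanSpace ℝ (Fin n) →ᵃ[ℝ] ℝ :=
  AffineMap.const ℝ _ 1 - (∑ j, ((s j : ℤ) : ℝ) •
    (EuclideanSpace.proj j : EuclideanSpace ℝ (Fin n) →L[ℝ] ℝ).toLinearMap).toAffineMap

theorem crossPolytopeIneq_apply {n : ℕ} (s : Fin n → ℤˣ) (y : EuclideanSpace ℝ (Fin n)) :
    crossPolytopeIneq n s y = 1 - ∑ j, ((s j : ℤ) : ℝ) * y j := by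
  simp [crossPolytopeIneq]

theorem sum_sign_mul_le {n : ℕ} (s : Fin n → ℤˣ) (y : EuclideanSpace ℝ (Fin n)) :
    ∑ j, ((s j : ℤ) : ℝ) * y j ≤ ∑ j, |y j| := by
  refine Finset.sum_le_sum fun j _ => ?_
  rcases Int.units_eq_one_or (s j) with h | h
  · simpa [h] using le_abs_self (y j)
  · simpa [h] using neg_le_abs (y j)

theorem exists_sum_sign_mul_eq {n : ℕ} (y : EuclideanSpace ℝ (Fin n)) :
    ∃ s : Fin n → ℤˣ, ∑ j, ((s j : ℤ) : ℝ) * y j = ∑ j, |y j| := by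
  choose s hs using fun j => exists_sign_mul_nonneg (y j)
  refine ⟨s, Finset.sum_congr rfl fun j _ => ?_⟩
  have h := hs j
  rcases Int.units_eq_one_or (s j) with h' | h'
  · rw [h'] at h ⊢
    simp only [Units.val_one, Int.cast_one, one_mul] at h ⊢
    rw [abs_of_nonneg h]
  · rw [h'] at h ⊢
    simp only [Units.val_neg, Units.val_one, Int.cast_neg, Int.cast_one, neg_mul, one_mul] at h ⊢
    rw [abs_of_nonpos (by linarith)]

theorem mem_polyhedron_crossPolytopeIneq {n : ℕ} {y : EuclideanSpace ℝ (Fin n)} :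
    y ∈ polyhedron (crossPolytopeIneq n) ↔ ∑ j, |y j| ≤ 1 := by
  constructor
  · intro h
    obtain ⟨s, hs⟩ := exists_sum_sign_mul_eq y
    have := h s
    rw [crossPolytopeIneq_apply, hs] at this
    linarith
  · intro h s
    rw [crossPolytopeIneq_apply]
    have := sum_sign_mul_le s y
    linarith

theorem sum_abs_eq_one_iff {n : ℕ} {y : EuclideanSpace ℝ (Fin n)} :
    (y ∈ polyhedron (crossPolytopeIneq n) ∧ ∃ s, crossPolytopeIneq n s y = 0) ↔
      ∑ j, |y j| = 1 := by
  constructor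
  · rintro ⟨h, s, hs⟩
    refine le_antisymm (mem_polyhedron_crossPolytopeIneq.1 h) ?_
    rw [crossPolytopeIneq_apply] at hs
    have := sum_sign_mul_le s y
    linarith
  · intro h
    refine ⟨mem_polyhedron_crossPolytopeIneq.2 h.le, ?_⟩
    obtain ⟨s, hs⟩ := exists_sum_sign_mul_eq y
    exact ⟨s, by rw [crossPolytopeIneq_apply, hs, h, sub_self]⟩

theorem isBounded_crossPolytope {n : ℕ} :
    Bornology.IsBounded (polyhedron (crossPolytopeIneq n)) := by
  refine EuclideanSpace.isBounded_of_abs_le_one fun y hy j => ?_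
  exact (Finset.single_le_sum (fun i _ => abs_nonneg (y i)) (Finset.mem_univ j)).trans
    (mem_polyhedron_crossPolytopeIneq.1 hy)

end CrossPolytope

/-! ### The join of circles is a sphere. -/

namespace joinedCircles

variable {m n : ℕ}

theorem facetMap_eq {i i' : Fin (n + 1)} {x y : stdSimplex ℝ (Fin (2 * m + 2))}
    (h : edgeSubdivSimplex i x = edgeSubdivSimplex i' y) :
    (joinedCircles m n).facetMap i x = (joinedCircles m n).facetMap i' y := by
  refine Triangulation.facetMap_eq_of_edgeSubdivSimplex_eq (T := joinedCircles m n)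
    (fun i => i) (fun i j hij => ?_) h
  have hlt : i < Fin.last n := Fin.lt_def.2 (by simp only [Fin.val_last]; have := j.2; omega)
  have : i + 1 = j := Fin.ext (by rw [Fin.val_add_one_of_lt hlt, hij])
  rw [glue_zero, this]

theorem edgeSubdivSimplex_permute {i : Fin (n + 1)} (x : stdSimplex ℝ (Fin (2 * m + 2)))
    {l : Fin (2 * m + 2)} (h0 : l ≠ 0) (h1 : l ≠ 1) :
    edgeSubdivSimplex i (stdSimplex.permute (swap l (partner l)) x) =
      stdSimplex.permute (swap l (partner l)) (edgeSubdivSimplex i x) := by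
  have hp0 := partner_ne_zero h1
  have hp1 := partner_ne_one h0
  refine Subtype.ext (ext_edge ?_ ?_ fun j hj0 hj1 => ?_)
  · change edgeSubdiv (n + 1) i _ 0 = edgeSubdiv (n + 1) i x.1 (swap l (partner l) 0)
    rw [swap_apply_of_ne_of_ne h0.symm hp0.symm, edgeSubdiv_zero, edgeSubdiv_zero]
    simp only [stdSimplex.permute, swap_apply_of_ne_of_ne h0.symm hp0.symm,
      swap_apply_of_ne_of_ne h1.symm hp1.symm]
  · change edgeSubdiv (n + 1) i _ 1 = edgeSubdiv (n + 1) i x.1 (swap l (partner l) 1)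
    rw [swap_apply_of_ne_of_ne h1.symm hp1.symm, edgeSubdiv_one, edgeSubdiv_one]
    simp only [stdSimplex.permute, swap_apply_of_ne_of_ne h0.symm hp0.symm,
      swap_apply_of_ne_of_ne h1.symm hp1.symm]
  · change edgeSubdiv (n + 1) i _ j = edgeSubdiv (n + 1) i x.1 (swap l (partner l) j)
    rw [edgeSubdiv_of_ne _ _ _ hj0 hj1, edgeSubdiv_of_ne]
    · rfl
    · rw [ne_eq, swap_apply_eq_iff, swap_apply_of_ne_of_ne h0.symm hp0.symm]
      exact hj0
    · rw [ne_eq, swap_apply_eq_iff, swap_apply_of_ne_of_ne h1.symm hp1.symm]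
      exact hj1

/-- For `l` equal to 0 or 1 this is the gluing that closes the cycle, between the last and the first
piece; for other `l` it is the gluing inside one facet, which commutes with the subdivision. -/
theorem facetMap_eq_of_permute {i i' : Fin (n + 1)} {x y : stdSimplex ℝ (Fin (2 * m + 2))}
    {l : Fin (2 * m + 2)} (hl : (edgeSubdivSimplex i x).1 l = 0)
    (h : edgeSubdivSimplex i' y = stdSimplex.permute (swap l (partner l)) (edgeSubdivSimplex i x)) :
    (joinedCircles m n).facetMap i x = (joinedCircles m n).facetMap i' y := by
  by_cases h0 : l = 0
  · subst h0
    rw [partner_zero] at h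
    rw [facetMap_eq (edgeSubdivSimplex_last (k := n) hl).symm,
      Triangulation.facetMap_eq_of_glue (glue_zero (Fin.last n)) hl
      (y := stdSimplex.permute (swap 0 1) (edgeSubdivSimplex i x))
      (fun j => by simp [stdSimplex.permute]), Fin.last_add_one]
    refine facetMap_eq ((edgeSubdivSimplex_first ?_).trans h.symm)
    simpa [stdSimplex.permute] using hl
  · by_cases h1 : l = 1
    · subst h1
      rw [partner_one, swap_comm] at h
      rw [facetMap_eq (edgeSubdivSimplex_first (k := n) hl).symm,
        Triangulation.facetMap_eq_of_glue (glue_one 0) hl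
        (y := stdSimplex.permute (swap 0 1) (edgeSubdivSimplex i x))
        (fun j => by simp [stdSimplex.permute])]
      have hlast : (0 : Fin (n + 1)) - 1 = Fin.last n := by
        rw [sub_eq_iff_eq_add, Fin.last_add_one]
      rw [hlast]
      refine facetMap_eq ((edgeSubdivSimplex_last ?_).trans h.symm)
      simpa [stdSimplex.permute] using hl
    · have hx : x.1 l = 0 := (edgeSubdiv_of_ne _ _ _ h0 h1).symm.trans hl
      rw [Triangulation.facetMap_eq_of_glue (glue_of_ne i h0 h1) hx
        (y := stdSimplex.permute (swap l (partner l)) x) (fun j => by simp [stdSimplex.permute])]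
      exact facetMap_eq ((edgeSubdivSimplex_permute x h0 h1).trans h.symm)

/-- The two points differ by swaps within pairs that have a zero coordinate. Each swap is realized
by gluings, so induction on the number of differing coordinates applies. -/
theorem facetMap_eq_of_wrap {i i' : Fin (n + 1)} {x y : stdSimplex ℝ (Fin (2 * m + 2))}
    (h : ∀ j, ((edgeSubdivSimplex i x).1 j = (edgeSubdivSimplex i' y).1 j ∧
        (edgeSubdivSimplex i x).1 (partner j) = (edgeSubdivSimplex i' y).1 (partner j)) ∨
      ((edgeSubdivSimplex i x).1 j = (edgeSubdivSimplex i' y).1 (partner j) ∧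
        (edgeSubdivSimplex i x).1 (partner j) = (edgeSubdivSimplex i' y).1 j ∧
        ((edgeSubdivSimplex i x).1 j = 0 ∨ (edgeSubdivSimplex i x).1 (partner j) = 0))) :
    (joinedCircles m n).facetMap i x = (joinedCircles m n).facetMap i' y := by
  obtain ⟨N, hN⟩ : ∃ N, (Finset.univ.filter fun j =>
    (edgeSubdivSimplex i x).1 j ≠ (edgeSubdivSimplex i' y).1 j).card = N := ⟨_, rfl⟩
  induction N using Nat.strong_induction_on generalizing i x with
  | _ N ih =>
    by_cases hall : ∀ j, (edgeSubdivSimplex i x).1 j = (edgeSubdivSimplex i' y).1 j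
    · exact facetMap_eq (Subtype.ext (funext hall))
    · push Not at hall
      obtain ⟨j, hj⟩ := hall
      obtain ⟨h1, h2, h3⟩ := (h j).resolve_left fun h' => hj h'.1
      obtain ⟨a, w, hw⟩ := exists_edgeSubdivSimplex_eq n.succ_pos
        (stdSimplex.permute (swap j (partner j)) (edgeSubdivSimplex i x))
      have hstep : (joinedCircles m n).facetMap i x = (joinedCircles m n).facetMap a w := by
        rcases h3 with h3 | h3
        · exact facetMap_eq_of_permute h3 hw
        · refine facetMap_eq_of_permute h3 ?_
          rw [hw, partner_partner, swap_comm]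
      have hwj : (edgeSubdivSimplex a w).1 j = (edgeSubdivSimplex i' y).1 j := by
        rw [hw, ← h2]
        simp [stdSimplex.permute]
      have hwp : (edgeSubdivSimplex a w).1 (partner j) =
          (edgeSubdivSimplex i' y).1 (partner j) := by
        rw [hw, ← h1]
        simp [stdSimplex.permute]
      have hwo : ∀ l, l ≠ j → l ≠ partner j →
          (edgeSubdivSimplex a w).1 l = (edgeSubdivSimplex i x).1 l := by
        intro l hl hl'
        rw [hw]
        simp [stdSimplex.permute, swap_apply_of_ne_of_ne hl hl']
      rw [hstep]
      refine ih _ ?_ (fun l => ?_) rfl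
      · rw [← hN]
        refine Finset.card_lt_card (Finset.ssubset_iff_of_subset ?_ |>.2 ⟨j, by simpa using hj,
          by simpa using hwj⟩)
        intro l
        simp only [Finset.mem_filter, Finset.mem_univ, true_and]
        intro hl
        by_cases hlj : l = j
        · exact absurd (hlj ▸ hwj) hl
        · by_cases hlp : l = partner j
          · exact absurd (hlp ▸ hwp) hl
          · rwa [hwo l hlj hlp] at hl
      · by_cases hlj : l = j
        · subst hlj
          exact Or.inl ⟨hwj, hwp⟩
        · by_cases hlp : l = partner j
          · subst hlp
            exact Or.inl ⟨hwp, by rwa [partner_partner]⟩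
          · have h4 : partner l ≠ j := by rwa [ne_eq, partner_eq_iff]
            have h5 : partner l ≠ partner j := fun h => hlj (partner_involutive.injective h)
            rw [hwo l hlj hlp, hwo _ h4 h5]
            exact h l

theorem isOfSphere : (joinedCircles m n).IsOfSphere := by
  refine isClosed.isOfSphere (crossPolytopeIneq (2 * m + 2)) isBounded_crossPolytope
    (y₀ := 0) (fun s => by simp [crossPolytopeIneq_apply])
    (fun i x => wrapMap (edgeSubdivSimplex i x))
    (fun i => isCellwiseAffine_wrapMap.comp_edgeSubdivSimplex i)
    (fun i => continuous_wrapMap.comp (continuous_edgeSubdivSimplex i))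
    ?_ (fun i x => ?_) ?_ ?_
  · intro i j i' π h x y hx hy
    have hperm : y = stdSimplex.permute π.symm x :=
      Subtype.ext (funext fun l => by
        have h3 := hy (π.symm l)
        rwa [apply_symm_apply] at h3)
    by_cases h0 : j = 0
    · subst h0
      rw [glue_zero] at h
      simp only [Option.some.injEq, Prod.mk.injEq] at h
      obtain ⟨rfl, rfl⟩ := h
      rw [symm_swap] at hperm
      by_cases hi : i = Fin.last n
      · subst hi
        have hy1 : y.1 1 = 0 := by simpa [hx] using hy 0
        rw [Fin.last_add_one, edgeSubdivSimplex_last hx, edgeSubdivSimplex_first hy1, hperm,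
          ← partner_zero, wrapMap_permute hx]
      · have hlt : i < Fin.last n := lt_of_le_of_ne (Fin.le_last i) hi
        rw [hperm, edgeSubdivSimplex_permute_swap (Fin.val_add_one_of_lt hlt) hx]
    · by_cases h1 : j = 1
      · subst h1
        rw [glue_one] at h
        simp only [Option.some.injEq, Prod.mk.injEq] at h
        obtain ⟨rfl, rfl⟩ := h
        rw [symm_swap] at hperm
        have hy0 : y.1 0 = 0 := by simpa [hx] using hy 1
        have hperm' : x = stdSimplex.permute (swap 0 1) y :=
          Subtype.ext (funext fun l => (hy l).symm)
        obtain ⟨a, rfl⟩ : ∃ a, i = a + 1 := ⟨i - 1, (sub_add_cancel i 1).symm⟩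
        rw [add_sub_cancel_right]
        by_cases hi : a = Fin.last n
        · subst hi
          rw [Fin.last_add_one, edgeSubdivSimplex_first hx, edgeSubdivSimplex_last hy0, hperm',
            ← partner_zero, wrapMap_permute hy0]
        · have hlt : a < Fin.last n := lt_of_le_of_ne (Fin.le_last a) hi
          rw [hperm', edgeSubdivSimplex_permute_swap (Fin.val_add_one_of_lt hlt) hy0]
      · rw [glue_of_ne i h0 h1] at h
        simp only [Option.some.injEq, Prod.mk.injEq] at h
        obtain ⟨rfl, rfl⟩ := h
        rw [symm_swap] at hperm
        rw [hperm, edgeSubdivSimplex_permute x h0 h1, wrapMap_permute]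
        exact (edgeSubdiv_of_ne _ _ _ h0 h1).trans hx
  · rw [sum_abs_eq_one_iff]
    exact (sum_abs_wrapCoord (edgeSubdivSimplex i x).2.1).trans (edgeSubdivSimplex i x).2.2
  · intro y hy hk
    have hy1 := sum_abs_eq_one_iff.1 ⟨hy, hk⟩
    obtain ⟨z, hz, hzy⟩ := exists_wrapCoord_eq fun j => y j
    have hsum : ∑ j, z j = 1 := by
      rw [← sum_abs_wrapCoord hz, hzy]
      exact hy1
    obtain ⟨i, x, hx⟩ := exists_edgeSubdivSimplex_eq n.succ_pos
      (⟨z, hz, hsum⟩ : stdSimplex ℝ (Fin (2 * m + 2)))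
    refine ⟨i, x, ?_⟩
    ext j
    simp only [hx]
    exact congrFun hzy j
  · intro i x i' y h
    refine facetMap_eq_of_wrap fun j => wrapCoord_eq_pair (edgeSubdivSimplex i x).2.1
      (edgeSubdivSimplex i' y).2.1 (fun j => ?_) j
    exact congrFun (congrArg WithLp.ofLp h) j

end joinedCircles

/-! ### Assembling the theorem. -/

theorem Triangulation.IsOfClosedConnectedManifold.isStronglyConnected {d : ℕ}
    {T : Triangulation d} (h : T.IsOfClosedConnectedManifold) : T.IsStronglyConnected :=
  isStronglyConnected_of_connectedSpace h.2.connected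

theorem Triangulation.IsOfClosedConnectedManifold.nonempty_facet {d : ℕ}
    {T : Triangulation d} (h : T.IsOfClosedConnectedManifold) : Nonempty T.Facet :=
  nonempty_facet_of_connectedSpace h.2.connected

theorem exists_sphere_of_vertexBound {d n : ℕ} (hd : 0 < d) (hn : 0 < n) (h : Even d → Even n) :
    ∃ T : Triangulation d, T.IsOfSphere ∧ T.numFacets = n ∧
      (T.numVertices : ℚ) = vertexBound d n := by
  by_cases hcase : Even d ∨ (Odd d ∧ n < d ∧ Even n)
  · have hne : Even n := hcase.elim h fun h => h.2.2
    -- The vertex count of the doubled simplex needs dimension at least 2.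
    have hd2 : 2 ≤ d := by
      rcases hcase with ⟨r, hr⟩ | ⟨_, h, _⟩ <;> omega
    obtain ⟨r, hr⟩ := hne
    obtain ⟨k, rfl⟩ : ∃ k, r = k + 1 := ⟨r - 1, by omega⟩
    obtain ⟨e, rfl⟩ : ∃ e, d = e + 1 := ⟨d - 1, by omega⟩
    refine ⟨doubledSimplex e k, doubledSimplex.isOfSphere, ?_, ?_⟩
    · rw [doubledSimplex.numFacets]
      omega
    · rw [doubledSimplex.numVertices (by omega), vertexBound, if_pos hcase, hr]
      push_cast
      ring
  · have hodd : Odd d := Nat.not_even_iff_odd.1 fun h => hcase (Or.inl h)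
    obtain ⟨m, rfl⟩ := hodd
    obtain ⟨k, rfl⟩ : ∃ k, n = k + 1 := ⟨n - 1, by omega⟩
    refine ⟨joinedCircles m k, joinedCircles.isOfSphere, joinedCircles.numFacets, ?_⟩
    rw [joinedCircles.numVertices, vertexBound, if_neg hcase]
    push_cast
    ring

theorem mainTheorem3 :
    -- dimension two
    (∀ T : Triangulation 2, T.IsOfClosedConnectedManifold →
      (T.numVertices : ℚ) ≤ (T.numFacets : ℚ) / 2 + 2) ∧
    -- odd dimension `d`, at least `d` facets
    (∀ d : ℕ, Odd d → ∀ T : Triangulation d, T.IsOfClosedConnectedManifold →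
      d ≤ T.numFacets → (T.numVertices : ℚ) ≤ vertexBound d T.numFacets) ∧
    -- odd dimension `d`, fewer than `d` facets, their number being even, or a single facet
    (∀ d : ℕ, Odd d → ∀ T : Triangulation d, T.IsOfClosedConnectedManifold →
      ((T.numFacets < d ∧ Even T.numFacets) ∨ T.numFacets = 1) →
      (T.numVertices : ℚ) ≤ vertexBound d T.numFacets) ∧
    -- sharpness in every dimension, for every feasible number of facets
    (∀ d : ℕ, 0 < d → ∀ n : ℕ,
      (IsFeasibleFacetNumber d n ↔ 0 < n ∧ (Even d → Even n)) ∧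
      (IsFeasibleFacetNumber d n →
        ∃ T : Triangulation d, T.IsOfSphere ∧ T.numFacets = n ∧
          (T.numVertices : ℚ) = vertexBound d n)) := by
  refine ⟨fun T hT => ?_, fun d hd T hT hn => ?_, fun d hd T hT hn => ?_, fun d hd n => ?_⟩
  · have h := Triangulation.two_mul_numVertices_le_of_two hT.1 hT.isStronglyConnected
      hT.nonempty_facet
    have h' : (2 : ℚ) * T.numVertices ≤ T.numFacets + 4 := by exact_mod_cast h
    linarith
  · have h := hT.1.numVertices_le_or hT.isStronglyConnected hT.nonempty_facet hd
    have hcase : ¬ (Even d ∨ (Odd d ∧ T.numFacets < d ∧ Even T.numFacets)) := by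
      rintro (h | h)
      · exact Nat.not_even_iff_odd.2 hd h
      · omega
    rw [vertexBound, if_neg hcase]
    -- From `f_d ≥ d` the other alternative gives `2 f_0 ≤ 2 f_d + d`, and equality is impossible
    -- since `d` is odd.
    have h1 : 2 * T.numVertices + 1 ≤ 2 * T.numFacets + d := by
      obtain ⟨r, hr⟩ := hd
      omega
    have h' : (2 : ℚ) * T.numVertices + 1 ≤ 2 * T.numFacets + d := by exact_mod_cast h1
    linarith
  · rcases hn with ⟨hlt, heven⟩ | hone
    · have h := hT.1.numVertices_le_or hT.isStronglyConnected hT.nonempty_facet hd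
      rw [vertexBound, if_pos (Or.inr ⟨hd, hlt, heven⟩)]
      have h1 : 2 * T.numVertices ≤ T.numFacets + 2 * d := by omega
      have h' : (2 : ℚ) * T.numVertices ≤ T.numFacets + 2 * d := by exact_mod_cast h1
      linarith
    · have h := hT.1.two_mul_numVertices_le hd
      have hcase : ¬ (Even d ∨ (Odd d ∧ T.numFacets < d ∧ Even T.numFacets)) := by
        rw [hone]
        rintro (h | h)
        · exact Nat.not_even_iff_odd.2 hd h
        · exact Nat.not_even_one h.2.2
      rw [vertexBound, if_neg hcase]
      rw [hone] at h ⊢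
      have h' : (2 : ℚ) * T.numVertices ≤ 1 * (d + 1) := by exact_mod_cast h
      push_cast
      linarith
  · have hiff : IsFeasibleFacetNumber d n ↔ 0 < n ∧ (Even d → Even n) := by
      constructor
      · rintro ⟨hn, T, hT, rfl⟩
        exact ⟨hn, fun h => hT.even_numFacets h⟩
      · rintro ⟨hn, h⟩
        obtain ⟨T, hT, hTn, -⟩ := exists_sphere_of_vertexBound hd hn h
        exact ⟨hn, T, hT.1, hTn⟩
    refine ⟨hiff, fun h => ?_⟩
    obtain ⟨hn, h⟩ := hiff.1 h
    exact exists_sphere_of_vertexBound hd hn h
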